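/- **Privacy–accuracy trade-off.** Let $d,n\ge 1$, let $D\subset\mathbb R^d$ be convex and compact with nonempty interior, and let $X=\{x\in D: G(x)\le 0,\ Ax=b\}$, where the components of $G$ are convex on $D$, $A\in\mathbb R^{s\times d}$ and $b\in\mathbb R^s$. Fix $\overline u>0$ and $0<\alpha<\beta$, and let $\mathcal S$ be the set of $h\in C^2(D)$ with $|\nabla h|\le\overline u$ on $D$ and $\alpha I_d\le\nabla^2h\le\beta I_d$ on the interior of $D$. Let $f_1,\dots,f_n\in\mathcal S$. Let $(e_k)_{k\ge1}$ be an orthonormal basis of $L_2(D)$ (with norm $\|\cdot\|$), and write $\Phi(\theta)=\sum_k\theta_ke_k$ for $\theta\in\ell_2$. For each $i\in\{1,\dots,n\}$ let $q_i>1$, $\gamma_i>0$, $\varepsilon_i>0$, $p_i=q_i/2$ and $$\epsilon_i=\frac{\sqrt{\zeta(2(q_i-p_i))}}{\gamma_i}=\frac{\sqrt{\zeta(q_i)}}{\gamma_i},$$ where $\zeta$ is the Riemann zeta function. Let $\eta_{i,k}$ ($1\le i\le n$, $k\ge1$) be independent random variables, $\eta_{i,k}$ having the Laplace distribution with density $\frac1{2b_{i,k}}e^{-|x|/b_{i,k}}$,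 $b_{i,k}=\gamma_i/k^{p_i}$, and put $\boldsymbol\eta_i=(\eta_{i,k})_k$ (which is in $\ell_2$ almost surely). Each agent $i$ forms $\hat f_i=f_i+\Phi(\boldsymbol\eta_i)$, selects $\hat f_i^s\in C^2(D)$ with $\|\hat f_i-\hat f_i^s\|<\varepsilon_i$, and takes the orthogonal projection $\tilde f_i=\mathrm{proj}_{\mathcal S}(\hat f_i^s)$. Here the projection is taken onto the $L_2(D)$-closure of $\mathcal S$, its value being represented by a function continuous on $D$; this is the projection onto $\mathcal S$ whenever the latter exists. Let $x^*=\operatorname{argmin}_{x\in X}\sum_if_i(x)$ and let the random vector $\tilde x^*=\operatorname{argmin}_{x\in X}\sum_i\tilde f_i(x)$ be the limit of whatever distributed algorithm the agents use; both minimizers are assumed to exist (the second almost surely). For $a,a'>0$ define $\kappa_{a,a'}:[0,\infty)\to[0,\infty)$ as the inverse of $$\kappa_{a,a'}^{-1}(r)=\left(\frac{a^2\pi^{d/2}}{d\,2^{d+3}\,\Gamma(d/2)}\,\lambda_D\Big(\frac{r_D}{d_D}\Big)^{d}r^4\,\mu_{a,a'}(r)^d\right)^{1/2},\qquad \mu_{a,a'}(r)=\frac{a\,r^2}{2\sqrt{aa'r^2+2(a'+a)\overline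 u\,r+4\overline u^2}},$$ where $r_D$ and $d_D$ are the inradius and the diameter of $D$, and $\lambda_D$ is the largest constant with $m(B(x,r)\cap D)\ge\lambda_D\,m(B(x,r))$ for all $x\in D$ and $0<r\le r_D$ ($m$ is Lebesgue measure, $B(x,r)$ the closed ball). Let $\kappa_n=\kappa_{n\alpha,n\beta}$. Then: 1. $\kappa_n$ is well defined and of class $\mathcal K_\infty$ (a strictly increasing continuous map $[0,\infty)\to[0,\infty)$ with $\kappa_n(0)=0$ and $\kappa_n(r)\to\infty$ as $r\to\infty$). 2. $\epsilon_i$ is the privacy level of agent $i$: for every measurable map $\mathcal F$ from $L_2(D)^n$ to a measurable space $\mathcal X$, the random map $\mathcal M(F)=\mathcal F\big((F_i+\Phi(\boldsymbol\eta_i))_{i}\big)$ is $\epsilon$-differentially private. That is, if $F,F'\in L_2(D)^n$ differ at most in their $i_0$-th entry and $F_{i_0}-F'_{i_0}$ has coefficients $\delta_k$ in the basis $(e_k)$ with $\|F_{i_0}-F'_{i_0}\|_{\mathcal V}:=\big(\sum_k(k^{q_{i_0}}\delta_k)^2\big)^{1/2}<\infty$, then $\mathbb P\{\mathcal M(F')\in\mathcal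 O\}\le e^{\epsilon_{i_0}\|F_{i_0}-F'_{i_0}\|_{\mathcal V}}\,\mathbb P\{\mathcal M(F)\in\mathcal O\}$ for every measurable $\mathcal O\subseteq\mathcal X$. 3. The expected deviation of the optimizer is finite and satisfies $$\mathbb E\,|\tilde x^*-x^*|\le\sum_{i=1}^n\left[\kappa_n\!\left(\frac{\zeta(q_i)}{\epsilon_i}\right)+\kappa_n(\varepsilon_i)\right].$$ -/

import Mathlib

open MeasureTheory ProbabilityTheory Set Filter Topology
open scoped Matrix

namespace PrivOpt

noncomputable section

/-- The Euclidean space `ℝ^d`. -/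
abbrev E (d : ℕ) : Type := EuclideanSpace ℝ (Fin d)

/-! ### The function space `L₂(D)` -/

/-- The real Hilbert space `L₂(D)` with respect to Lebesgue measure on `D ⊆ ℝ^d`. -/
abbrev L2 {d : ℕ} (D : Set (E d)) : Type := Lp ℝ 2 (volume.restrict D)

/-- `L₂(D)` carries its Borel σ-algebra (and `L₂(D)^n` the product σ-algebra). -/
instance instMeasurableSpaceL2 {d : ℕ} (D : Set (E d)) : MeasurableSpace (L2 D) := borel _

instance instBorelSpaceL2 {d : ℕ} (D : Set (E d)) : BorelSpace (L2 D) := ⟨rfl⟩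

open Classical in
/-- The class in `L₂(D)` of a function that is square integrable on `D`
(zero for other functions; every function continuous on a compact `D` is square integrable). -/
def toL2 {d : ℕ} (D : Set (E d)) (h : E d → ℝ) : L2 D :=
  if hh : MemLp h 2 (volume.restrict D) then hh.toLp h else 0

/-- The map `Φ` from coefficient sequences to functions, for an orthonormal basis `e` of `L₂(D)`.
The series converges exactly for square-summable sequences. -/
def Phi {d : ℕ} {D : Set (E d)} (e : HilbertBasis ℕ ℝ (L2 D)) (θ : ℕ → ℝ) : L2 D :=
  ∑' k, θ k • e k

/-! ### The class of objective functions and the feasible set -/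

/-- Twice continuously differentiable functions on `D` with gradient bounded by `ubar` on `D` and
`α I ≤ ∇²h ≤ β I` on the interior of `D`. -/
def classS {d : ℕ} (D : Set (E d)) (α β ubar : ℝ) : Set (E d → ℝ) :=
  {h | ContDiffOn ℝ 2 h D ∧
    (∀ x ∈ D, ‖gradientWithin h D x‖ ≤ ubar) ∧
    ∀ x ∈ interior D, ∀ v : E d,
      α * ‖v‖ ^ 2 ≤ fderiv ℝ (fderiv ℝ h) x v v ∧ fderiv ℝ (fderiv ℝ h) x v v ≤ β * ‖v‖ ^ 2}

/-- The feasible set `{x ∈ D : G(x) ≤ 0, A x = b}`. -/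
def feasibleSet {d m s : ℕ} (D : Set (E d)) (G : Fin m → E d → ℝ)
    (A : Matrix (Fin s) (Fin d) ℝ) (b : Fin s → ℝ) : Set (E d) :=
  {x | x ∈ D ∧ (∀ j, G j x ≤ 0) ∧ A *ᵥ x.ofLp = b}

/-- `x` is a minimizer of `F` over `X`. -/
def IsArgmin {d : ℕ} (F : E d → ℝ) (X : Set (E d)) (x : E d) : Prop :=
  x ∈ X ∧ ∀ y ∈ X, F x ≤ F y

/-! ### The perturbation procedure -/

/-- The Laplace distribution with scale `b > 0`, of density `(1 / 2b) exp (-|x| / b)`. -/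
def laplace (b : ℝ) : Measure ℝ :=
  volume.withDensity fun x => ENNReal.ofReal (1 / (2 * b) * Real.exp (-|x| / b))

/-- `y` is an orthogonal projection of `x` onto `K`: a point of `K` nearest to `x`. -/
def IsProj {H : Type*} [NormedAddCommGroup H] (K : Set H) (x y : H) : Prop :=
  y ∈ K ∧ ∀ z ∈ K, ‖x - y‖ ≤ ‖x - z‖

/-- One agent's procedure with objective `f` and noise sequence `θ`: `fs` is a `C²` function on `D`
at `L₂(D)`-distance less than `δ` from `f + Φ(θ)`, and `ft` is a continuous function on `D`
representing the projection of `fs` onto the closed convex set generated by `S` in `L₂(D)`, namely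
the `L₂(D)`-closure of (the convex set) `S`. -/
def IsPerturbation {d : ℕ} {D : Set (E d)} (e : HilbertBasis ℕ ℝ (L2 D)) (S : Set (E d → ℝ))
    (f : E d → ℝ) (θ : ℕ → ℝ) (δ : ℝ) (fs ft : E d → ℝ) : Prop :=
  ContDiffOn ℝ 2 fs D ∧
  ‖(toL2 D f + Phi e θ) - toL2 D fs‖ < δ ∧
  ContinuousOn ft D ∧
  IsProj (closure (toL2 D '' S)) (toL2 D fs) (toL2 D ft)

/-! ### Differential privacy -/

/-- The adjacency space `V_q`: functions whose coefficients `δ` (indexed here from `0`) satisfy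
`∑ ((k+1)^q δ_k)² < ∞`. -/
def adjSpace {d : ℕ} {D : Set (E d)} (e : HilbertBasis ℕ ℝ (L2 D)) (q : ℝ) : Set (L2 D) :=
  {g | Summable fun k : ℕ => (((k : ℝ) + 1) ^ q * e.repr g k) ^ 2}

/-- The norm of `V_q`. -/
def adjNorm {d : ℕ} {D : Set (E d)} (e : HilbertBasis ℕ ℝ (L2 D)) (q : ℝ) (g : L2 D) : ℝ :=
  Real.sqrt (∑' k : ℕ, (((k : ℝ) + 1) ^ q * e.repr g k) ^ 2)

/-- `eps`-differential privacy of a random map on `L₂(D)^n`: changing the `i₀`-th function by an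
element of `V_{q_{i₀}}` changes the probability of every event by at most the factor
`exp (eps_{i₀} ‖f_{i₀} - f'_{i₀}‖)`. -/
def IsDiffPrivate {d n : ℕ} {D : Set (E d)} {Ω 𝒳 : Type*} [MeasurableSpace Ω] [MeasurableSpace 𝒳]
    (P : Measure Ω) (e : HilbertBasis ℕ ℝ (L2 D)) (q eps : Fin n → ℝ)
    (M : (Fin n → L2 D) → Ω → 𝒳) : Prop :=
  ∀ (F F' : Fin n → L2 D) (i₀ : Fin n), (∀ i, i ≠ i₀ → F i = F' i) →
    F i₀ - F' i₀ ∈ adjSpace e (q i₀) →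
    ∀ O : Set 𝒳, MeasurableSet O →
      P {ω | M F' ω ∈ O} ≤
        ENNReal.ofReal (Real.exp (eps i₀ * adjNorm e (q i₀) (F i₀ - F' i₀))) * P {ω | M F ω ∈ O}

/-! ### The comparison function `κ` -/

/-- The inradius of `D`. -/
def inradius {d : ℕ} (D : Set (E d)) : ℝ :=
  sSup {r : ℝ | 0 ≤ r ∧ ∃ c, Metric.closedBall c r ⊆ D}

/-- The largest `lam` with `m(B(x,r) ∩ D) ≥ lam * m(B(x,r))` for all `x ∈ D` and
`0 < r ≤ inradius D`. -/
def portion {d : ℕ} (D : Set (E d)) : ℝ :=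
  sInf {t : ℝ | ∃ x ∈ D, ∃ r : ℝ, 0 < r ∧ r ≤ inradius D ∧
    t = volume.real (Metric.closedBall x r ∩ D) / volume.real (Metric.closedBall x r)}

/-- The function `μ_{α,β}`. -/
def mu (α β ubar r : ℝ) : ℝ :=
  α * r ^ 2 / (2 * Real.sqrt (α * β * r ^ 2 + 2 * (β + α) * ubar * r + 4 * ubar ^ 2))

/-- The function `κ_{α,β}⁻¹` on `[0, ∞)`. -/
def kappaInv {d : ℕ} (D : Set (E d)) (α β ubar r : ℝ) : ℝ :=
  Real.sqrt
    (α ^ 2 * Real.pi ^ ((d : ℝ) / 2) / (d * 2 ^ (d + 3) * Real.Gamma ((d : ℝ) / 2)) *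
      portion D * (inradius D / Metric.diam D) ^ d * r ^ 4 * mu α β ubar r ^ d)

/-- The function `κ_{α,β}`, inverse of `kappaInv` on `[0, ∞)`. -/
def kappa {d : ℕ} (D : Set (E d)) (α β ubar : ℝ) : ℝ → ℝ :=
  Function.invFunOn (kappaInv D α β ubar) (Ici 0)

/-- Class `K_∞`: strictly increasing continuous functions `[0,∞) → [0,∞)` vanishing at `0` and
tending to `∞`. -/
def IsClassKInfty (κ : ℝ → ℝ) : Prop :=
  MapsTo κ (Ici 0) (Ici 0) ∧ StrictMonoOn κ (Ici 0) ∧ ContinuousOn κ (Ici 0) ∧ κ 0 = 0 ∧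
    Tendsto κ atTop atTop

/-- The Riemann zeta function at a real argument (real for arguments greater than `1`). -/
def zeta (s : ℝ) : ℝ := (riemannZeta (s : ℂ)).re

end

end PrivOpt

namespace PrivOpt

/-! ### Analysis of the comparison function -/

section Comparison

variable {d : ℕ} {D : Set (E d)} {a a' u : ℝ}

/-! Accuracy. Put a = nα and a' = nβ, let x and y minimize ∑ f_i and ∑ g_i over X, with all f_i, g_i
in the `L₂(D)`-closure of S, and let δ_i = f_i - g_i, r = ‖y - x‖. Adding the quadratic growth
inequalities of the two sums gives a r² ≤ ∑ (δ_i(y) - δ_i(x)). This splits r into pieces r_i with r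
≤ ∑ r_i such that |δ_i| ≥ a r_i²/2 at x or at y. As δ_i is 2u-Lipschitz, |δ_i| ≥ a r_i²/4 on a small
ball around that point, and integrating over its intersection with D gives ‖δ_i‖² ≥ 2 κ⁻¹(r_i)².
Hence r ≤ ∑ κ(‖δ_i‖/√2) (`norm_sub_argmin_le`).

Projection onto a convex set brings g_i = f̃_i no farther from f_i than f̂_i^s is, so ‖δ_i‖ ≤
‖Φ(η_i)‖ + ε_i, the last term being the smoothing accuracy. Since κ is subadditive, it remains to
average κ(‖Φ(η_i)‖/√2). Weighted AM-GM shows that κ⁻¹ lies above its tangents (`kappaInv_tangent`),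
so κ lies below its own, which gives Jensen's inequality in an explicit form (`kappa_norm_div_le`).
The factor √2 fits the noise exactly: E‖Φ(η_i)‖² = 2γ_i²ζ(q_i) = 2(ζ(q_i)/ϵ_i)².

Privacy. A change of one function is a translation of its noise coefficients. For finitely many
coefficients the Laplace densities change by at most exp(∑ |δ_k|/b_k), and Cauchy-Schwarz bounds
this exponent uniformly in the truncation (`sum_abs_div_le`). The domination of laws survives the
almost sure limit (`map_le_smul_map_of_tendsto`). -/

theorem mu_nonneg (ha : 0 < a) (r : ℝ) : 0 ≤ mu a a' u r := by
  unfold mu; positivity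

theorem mu_pos (ha : 0 < a) (ha' : 0 < a') (hu : 0 < u) {r : ℝ} (hr : 0 < r) :
    0 < mu a a' u r := by
  unfold mu; positivity

theorem mu_strictMonoOn (ha : 0 < a) (ha' : 0 < a') (hu : 0 < u) :
    StrictMonoOn (mu a a' u) (Ici 0) := by
  intro x hx y hy hxy
  simp only [mem_Ici] at hx hy
  have hy' : 0 < y := hx.trans_lt hxy
  unfold mu
  set P := a * a' * x ^ 2 + 2 * (a' + a) * u * x + 4 * u ^ 2 with hP
  set Q := a * a' * y ^ 2 + 2 * (a' + a) * u * y + 4 * u ^ 2 with hQ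
  have hP0 : 0 < P := by positivity
  have hQ0 : 0 < Q := by positivity
  have key : x ^ 2 * √Q < y ^ 2 * √P := by
    have e1 : x ^ 2 * √Q = √((x ^ 2) ^ 2 * Q) := by
      rw [Real.sqrt_mul (by positivity), Real.sqrt_sq (by positivity)]
    have e2 : y ^ 2 * √P = √((y ^ 2) ^ 2 * P) := by
      rw [Real.sqrt_mul (by positivity), Real.sqrt_sq (by positivity)]
    rw [e1, e2]
    apply Real.sqrt_lt_sqrt (by positivity)
    have h2 : 0 ≤ y ^ 2 - x ^ 2 := by nlinarith
    have h3 : 0 ≤ y ^ 3 - x ^ 3 := sub_nonneg.2 (pow_le_pow_left₀ hx hxy.le 3)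
    have h4 : 0 < y ^ 4 - x ^ 4 := sub_pos.2 (pow_lt_pow_left₀ hxy hx (by norm_num))
    -- The radicand has degree 2 and is weighed against a fourth power, so every coefficient of the
    -- difference keeps a factor y^j - x^j with j ≥ 2.
    have : (y ^ 2) ^ 2 * P - (x ^ 2) ^ 2 * Q = a * a' * (x ^ 2 * y ^ 2) * (y ^ 2 - x ^ 2)
        + 2 * (a' + a) * u * (x * y) * (y ^ 3 - x ^ 3) + 4 * u ^ 2 * (y ^ 4 - x ^ 4) := by
      rw [hP, hQ]; ring
    have : 0 < (y ^ 2) ^ 2 * P - (x ^ 2) ^ 2 * Q := by rw [this]; positivity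
    linarith
  rw [div_lt_div_iff₀ (by positivity) (by positivity)]
  nlinarith

theorem mu_continuousOn (ha : 0 < a) (ha' : 0 < a') (hu : 0 < u) :
    ContinuousOn (mu a a' u) (Ici 0) := by
  unfold mu
  refine ContinuousOn.div (by fun_prop) (by fun_prop) fun x hx => ?_
  simp only [mem_Ici] at hx
  positivity

/-- The constant factor in the definition of `kappaInv`. -/
noncomputable def kappaCoeff {d : ℕ} (D : Set (E d)) (a : ℝ) : ℝ :=
  a ^ 2 * Real.pi ^ ((d : ℝ) / 2) / (d * 2 ^ (d + 3) * Real.Gamma ((d : ℝ) / 2)) *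
      portion D * (inradius D / Metric.diam D) ^ d

theorem kappaInv_eq (hK : 0 ≤ kappaCoeff D a) (r : ℝ) :
    kappaInv D a a' u r = √(kappaCoeff D a) * r ^ 2 * √(mu a a' u r ^ d) := by
  have : kappaInv D a a' u r = √(kappaCoeff D a * r ^ 4 * mu a a' u r ^ d) := rfl
  rw [this, Real.sqrt_mul (by positivity), Real.sqrt_mul hK,
    show r ^ 4 = (r ^ 2) ^ 2 by ring, Real.sqrt_sq (by positivity)]

theorem kappaInv_sq (ha : 0 < a) (hK : 0 ≤ kappaCoeff D a) (r : ℝ) :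
    kappaInv D a a' u r ^ 2 = kappaCoeff D a * r ^ 4 * mu a a' u r ^ d :=
  Real.sq_sqrt (mul_nonneg (by positivity) (pow_nonneg (mu_nonneg ha r) d))

theorem kappaInv_nonneg (r : ℝ) : 0 ≤ kappaInv D a a' u r := Real.sqrt_nonneg _

theorem kappaInv_zero : kappaInv D a a' u 0 = 0 := by
  simp [kappaInv]

theorem kappaInv_pos (ha : 0 < a) (ha' : 0 < a') (hu : 0 < u) (hK : 0 < kappaCoeff D a) {r : ℝ}
    (hr : 0 < r) : 0 < kappaInv D a a' u r := by
  have := mu_pos ha ha' hu hr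
  rw [kappaInv_eq hK.le]; positivity

theorem kappaInv_strictMonoOn (ha : 0 < a) (ha' : 0 < a') (hu : 0 < u)
    (hK : 0 < kappaCoeff D a) : StrictMonoOn (kappaInv D a a' u) (Ici 0) := by
  intro x hx y hy hxy
  have hmu := (mu_strictMonoOn ha ha' hu hx hy hxy).le
  simp only [mem_Ici] at hx hy
  have hy' : 0 < y := hx.trans_lt hxy
  have h1 := mu_pos ha ha' hu hy'
  rw [kappaInv_eq hK.le, kappaInv_eq hK.le]
  calc √(kappaCoeff D a) * x ^ 2 * √(mu a a' u x ^ d)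
      ≤ √(kappaCoeff D a) * x ^ 2 * √(mu a a' u y ^ d) := by
        gcongr; exact mu_nonneg ha x
    _ < √(kappaCoeff D a) * y ^ 2 * √(mu a a' u y ^ d) := by gcongr

theorem kappaInv_continuousOn (ha : 0 < a) (ha' : 0 < a') (hu : 0 < u) :
    ContinuousOn (kappaInv D a a' u) (Ici 0) := by
  unfold kappaInv
  have := mu_continuousOn ha ha' hu
  fun_prop

theorem kappaInv_tendsto (ha : 0 < a) (ha' : 0 < a') (hu : 0 < u)
    (hK : 0 < kappaCoeff D a) : Tendsto (kappaInv D a a' u) atTop atTop := by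
  have h1 := mu_pos ha ha' hu one_pos
  have hc : 0 < √(kappaCoeff D a) * √(mu a a' u 1 ^ d) := by positivity
  refine tendsto_atTop_mono' _ ?_ (tendsto_id.const_mul_atTop hc)
  filter_upwards [eventually_ge_atTop 1] with r hr
  have hr0 : (0 : ℝ) ≤ r := by linarith
  have hmu := (mu_strictMonoOn ha ha' hu).monotoneOn (by simp : (1 : ℝ) ∈ Ici 0) hr0 hr
  rw [kappaInv_eq hK.le, id]
  calc √(kappaCoeff D a) * √(mu a a' u 1 ^ d) * r
      = √(kappaCoeff D a) * r * √(mu a a' u 1 ^ d) := by ring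
    _ ≤ √(kappaCoeff D a) * r ^ 2 * √(mu a a' u r ^ d) := by
        gcongr; nlinarith

/-- Up to a constant, the function is r² times an increasing factor, and s² + t² ≤ (s + t)². This
yields the subadditivity of `kappa`. -/
theorem kappaInv_superadditive (ha : 0 < a) (ha' : 0 < a') (hu : 0 < u)
    (hK : 0 ≤ kappaCoeff D a) {s t : ℝ} (hs : 0 ≤ s) (ht : 0 ≤ t) :
    kappaInv D a a' u s + kappaInv D a a' u t ≤ kappaInv D a a' u (s + t) := by
  have m := (mu_strictMonoOn ha ha' hu).monotoneOn
  have hst : (0 : ℝ) ≤ s + t := by positivity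
  have h1 := m hs hst (by linarith)
  have h2 := m ht hst (by linarith)
  have := mu_nonneg (a' := a') (u := u) ha s
  have := mu_nonneg (a' := a') (u := u) ha t
  rw [kappaInv_eq hK, kappaInv_eq hK, kappaInv_eq hK]
  calc _ ≤ √(kappaCoeff D a) * s ^ 2 * √(mu a a' u (s + t) ^ d) +
        √(kappaCoeff D a) * t ^ 2 * √(mu a a' u (s + t) ^ d) := by gcongr
    _ = √(kappaCoeff D a) * (s ^ 2 + t ^ 2) * √(mu a a' u (s + t) ^ d) := by ring
    _ ≤ _ := by gcongr; nlinarith [mul_nonneg hs ht]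

/-- A form of the weighted inequality between arithmetic and geometric means. -/
theorem le_of_pow_mul_pow_eq (d : ℕ) {x g l l' : ℝ} (hx : 0 ≤ x) (hg : 0 ≤ g) (hl : 0 ≤ l)
    (hl' : 0 ≤ l') (h : g ^ 4 * l ^ d * l' ^ d = x ^ (8 + 4 * d)) :
    (8 + 4 * d) * x ≤ 4 * g + d * l + d * l' + (4 + 2 * d) := by
  have hs : (0 : ℝ) < 8 + 4 * d := by positivity
  -- The fourth variable is the constant 1. Its weight 4 + 2d completes the weights to 8 + 4d, so x
  -- comes out to the first power.
  have key := Real.geom_mean_le_arith_mean4_weighted (w₁ := 4 / (8 + 4 * d))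
    (w₂ := d / (8 + 4 * d)) (w₃ := d / (8 + 4 * d)) (w₄ := (4 + 2 * d) / (8 + 4 * d))
    (by positivity) (by positivity) (by positivity) (by positivity) hg hl hl' zero_le_one
    (by field_simp; ring)
  have e : x = g ^ ((4 : ℝ) / (8 + 4 * d)) * l ^ ((d : ℝ) / (8 + 4 * d)) *
      l' ^ ((d : ℝ) / (8 + 4 * d)) * 1 ^ (((4 : ℝ) + 2 * d) / (8 + 4 * d)) := by
    rw [Real.one_rpow, mul_one, div_eq_mul_inv, Real.rpow_mul hg, div_eq_mul_inv,
      Real.rpow_mul hl, Real.rpow_mul hl', ← Real.mul_rpow (by positivity) (by positivity),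
      ← Real.mul_rpow (by positivity) (by positivity), Real.rpow_natCast, Real.rpow_natCast]
    rw [show (4 : ℝ) = ((4 : ℕ) : ℝ) by norm_num, Real.rpow_natCast, h]
    rw [show ((8 : ℝ) + (4 : ℕ) * d) = ((8 + 4 * d : ℕ) : ℝ) by push_cast; ring]
    rw [Real.pow_rpow_inv_natCast hx (by omega)]
  rw [← e] at key
  have := mul_le_mul_of_nonneg_left key hs.le
  calc _ ≤ _ := this
    _ = _ := by field_simp

/-- `kappaInv` lies above a tangent line at each positive point. -/
theorem kappaInv_tangent (ha : 0 < a) (ha' : 0 < a') (hu : 0 < u)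
    (hK : 0 < kappaCoeff D a) {r₀ : ℝ} (hr₀ : 0 < r₀) :
    ∃ c > 0, ∀ r, 0 ≤ r →
      kappaInv D a a' u r₀ + c * (r - r₀) ≤ kappaInv D a a' u r := by
  set g := kappaInv D a a' u with hg
  have hg0 : 0 < g r₀ := kappaInv_pos ha ha' hu hK hr₀
  set L := fun r => a * r + 2 * u with hL
  set L' := fun r => a' * r + 2 * u with hL'
  have hLp : ∀ r, 0 ≤ r → 0 < L r := fun r hr => by simp only [hL]; positivity
  have hLp' : ∀ r, 0 ≤ r → 0 < L' r := fun r hr => by simp only [hL']; positivity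
  -- The radicand in `mu` factors as L r * L' r, so the fourth power removes both layers of square
  -- roots and leaves a relation between g, two affine functions and a monomial.
  have g4 : ∀ r, 0 ≤ r →
      g r ^ 4 * L r ^ d * L' r ^ d = kappaCoeff D a ^ 2 * (a / 2) ^ (2 * d) * r ^ (8 + 4 * d) := by
    intro r hr
    have h1 : mu a a' u r ^ 2 * (L r * L' r) = (a / 2) ^ 2 * r ^ 4 := by
      have hQ : a * a' * r ^ 2 + 2 * (a' + a) * u * r + 4 * u ^ 2 = L r * L' r := by
        simp only [hL, hL']; ring
      unfold mu
      have := hLp r hr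
      have := hLp' r hr
      rw [hQ, div_pow, mul_pow 2, Real.sq_sqrt (by positivity)]
      field_simp
    calc g r ^ 4 * L r ^ d * L' r ^ d = (g r ^ 2) ^ 2 * (L r * L' r) ^ d := by
          rw [mul_pow]; ring
      _ = kappaCoeff D a ^ 2 * r ^ 8 * (mu a a' u r ^ 2 * (L r * L' r)) ^ d := by
          rw [hg, kappaInv_sq ha hK.le, mul_pow _ _ d]; ring_nf
      _ = _ := by rw [h1, mul_pow, ← pow_mul, ← pow_mul]; ring
  set σ := a * r₀ / L r₀ with hσ
  set σ' := a' * r₀ / L' r₀ with hσ'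
  have hσ1 : σ ≤ 1 := by
    rw [hσ, div_le_one (hLp _ hr₀.le)]; simp only [hL]; linarith
  have hσ1' : σ' ≤ 1 := by
    rw [hσ', div_le_one (hLp' _ hr₀.le)]; simp only [hL']; linarith
  have hp := hLp _ hr₀.le
  have hp' := hLp' _ hr₀.le
  have hεpos : 0 < 8 + 4 * (d : ℝ) - d * σ - d * σ' := by
    have : (d : ℝ) * σ ≤ d * 1 := by gcongr
    have : (d : ℝ) * σ' ≤ d * 1 := by gcongr
    have : (0 : ℝ) ≤ d := by positivity
    linarith
  -- Apply AM-GM to the ratios with their values at r₀. All ratios but g r / g r₀ are affine in r,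
  -- and there is equality at r₀; this slope is what results. It is positive because σ, σ' ≤ 1.
  refine ⟨g r₀ / r₀ * ((8 + 4 * d - d * σ - d * σ') / 4), by positivity, fun r hr => ?_⟩
  have hlin : L r / L r₀ = 1 + σ * (r / r₀ - 1) := by
    rw [hσ]; field_simp; simp only [hL]; ring
  have hlin' : L' r / L' r₀ = 1 + σ' * (r / r₀ - 1) := by
    rw [hσ']; field_simp; simp only [hL']; ring
  have key := le_of_pow_mul_pow_eq d (x := r / r₀) (g := g r / g r₀) (l := L r / L r₀)
    (l' := L' r / L' r₀) (by positivity) (div_nonneg (kappaInv_nonneg _) hg0.le)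
    (div_nonneg (hLp r hr).le hp.le) (div_nonneg (hLp' r hr).le hp'.le) (by
      simp only [div_pow]
      rw [div_mul_div_comm, div_mul_div_comm, g4 r hr, g4 r₀ hr₀.le]
      rw [mul_div_mul_left _ _ (by positivity)])
  rw [hlin, hlin'] at key
  have e : g r = g r₀ * (g r / g r₀) := by field_simp
  have e2 : g r₀ / r₀ * ((8 + 4 * d - d * σ - d * σ') / 4) * (r - r₀) =
      g r₀ * ((8 + 4 * d - d * σ - d * σ') / 4 * (r / r₀ - 1)) := by
    field_simp
  rw [e2, e]
  have : 1 + (8 + 4 * d - d * σ - d * σ') / 4 * (r / r₀ - 1) ≤ g r / g r₀ := by linarith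
  nlinarith

/-! ### The inverse function `kappa` -/

theorem kappaInv_bijOn (ha : 0 < a) (ha' : 0 < a') (hu : 0 < u) (hK : 0 < kappaCoeff D a) :
    BijOn (kappaInv D a a' u) (Ici 0) (Ici 0) := by
  refine ⟨fun r _ => kappaInv_nonneg r, (kappaInv_strictMonoOn ha ha' hu hK).injOn, ?_⟩
  intro y hy
  obtain ⟨R, hR0, hR⟩ := ((eventually_ge_atTop (0 : ℝ)).and
    ((kappaInv_tendsto (D := D) ha ha' hu hK).eventually_ge_atTop y)).exists
  have := intermediate_value_Icc hR0
    ((kappaInv_continuousOn (D := D) ha ha' hu).mono Icc_subset_Ici_self)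
  rw [kappaInv_zero] at this
  obtain ⟨x, hx, hxy⟩ := this ⟨hy, hR⟩
  exact ⟨x, hx.1, hxy⟩

theorem kappa_invOn (ha : 0 < a) (ha' : 0 < a') (hu : 0 < u) (hK : 0 < kappaCoeff D a) :
    InvOn (kappa D a a' u) (kappaInv D a a' u) (Ici 0) (Ici 0) :=
  (kappaInv_bijOn ha ha' hu hK).invOn_invFunOn

theorem kappa_nonneg (ha : 0 < a) (ha' : 0 < a') (hu : 0 < u) (hK : 0 < kappaCoeff D a) {y : ℝ}
    (hy : 0 ≤ y) : 0 ≤ kappa D a a' u y :=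
  (kappaInv_bijOn ha ha' hu hK).surjOn.mapsTo_invFunOn hy

theorem kappa_strictMonoOn (ha : 0 < a) (ha' : 0 < a') (hu : 0 < u) (hK : 0 < kappaCoeff D a) :
    StrictMonoOn (kappa D a a' u) (Ici 0) := by
  intro x hx y hy hxy
  have h := (kappa_invOn ha ha' hu hK).2
  rw [← (kappaInv_strictMonoOn ha ha' hu hK).lt_iff_lt (kappa_nonneg ha ha' hu hK hx)
    (kappa_nonneg ha ha' hu hK hy), h hx, h hy]
  exact hxy

theorem le_kappa (ha : 0 < a) (ha' : 0 < a') (hu : 0 < u) (hK : 0 < kappaCoeff D a) {r y : ℝ}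
    (hr : 0 ≤ r) (h : kappaInv D a a' u r ≤ y) : r ≤ kappa D a a' u y := by
  have hy : 0 ≤ y := (kappaInv_nonneg r).trans h
  rw [← (kappaInv_strictMonoOn ha ha' hu hK).le_iff_le hr (kappa_nonneg ha ha' hu hK hy),
    (kappa_invOn ha ha' hu hK).2 hy]
  exact h

theorem kappa_subadditive (ha : 0 < a) (ha' : 0 < a') (hu : 0 < u) (hK : 0 < kappaCoeff D a)
    {x y : ℝ} (hx : 0 ≤ x) (hy : 0 ≤ y) :
    kappa D a a' u (x + y) ≤ kappa D a a' u x + kappa D a a' u y := by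
  have h := (kappa_invOn ha ha' hu hK).2
  have hxy : 0 ≤ x + y := by positivity
  have kx := kappa_nonneg ha ha' hu hK hx
  have ky := kappa_nonneg ha ha' hu hK hy
  rw [← (kappaInv_strictMonoOn ha ha' hu hK).le_iff_le (kappa_nonneg ha ha' hu hK hxy)
    (add_nonneg kx ky), h hxy]
  have := kappaInv_superadditive ha ha' hu hK.le kx ky
  rwa [h hx, h hy] at this

/-- Inverting a tangent line below `kappaInv` gives a line above `kappa`, with the inverse slope.
This is the concavity used in place of Jensen's inequality. -/
theorem kappa_tangent (ha : 0 < a) (ha' : 0 < a') (hu : 0 < u) (hK : 0 < kappaCoeff D a)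
    {y₀ : ℝ} (hy₀ : 0 < y₀) : ∃ c > 0, ∀ y, 0 ≤ y →
      kappa D a a' u y ≤ kappa D a a' u y₀ + c * (y - y₀) := by
  have h := (kappa_invOn ha ha' hu hK).2
  have k0 : 0 < kappa D a a' u y₀ := by
    refine (kappa_nonneg ha ha' hu hK le_rfl).trans_lt
      (kappa_strictMonoOn ha ha' hu hK (by simp) hy₀.le hy₀)
  obtain ⟨c, hc, hcr⟩ := kappaInv_tangent ha ha' hu hK k0
  refine ⟨c⁻¹, inv_pos.2 hc, fun y hy => ?_⟩
  have := hcr _ (kappa_nonneg ha ha' hu hK hy)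
  rw [h hy, h hy₀.le] at this
  have h2 : kappa D a a' u y - kappa D a a' u y₀ ≤ c⁻¹ * (y - y₀) := by
    rw [inv_mul_eq_div, le_div_iff₀ hc]; linarith
  linarith

theorem kappa_isClassKInfty (ha : 0 < a) (ha' : 0 < a') (hu : 0 < u)
    (hK : 0 < kappaCoeff D a) : IsClassKInfty (kappa D a a' u) := by
  have hinv := kappa_invOn ha ha' hu hK
  have hz : kappa D a a' u 0 = 0 := by
    have := hinv.1 (by simp : (0 : ℝ) ∈ Ici 0)
    rwa [kappaInv_zero] at this
  have hmono := kappa_strictMonoOn ha ha' hu hK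
  refine ⟨fun y hy => kappa_nonneg ha ha' hu hK hy, hmono, ?_, hz, ?_⟩
  -- A monotone surjection of the half-line onto itself has no jumps.
  · let F : Ici (0 : ℝ) → Ici (0 : ℝ) := fun y => ⟨kappa D a a' u y, kappa_nonneg ha ha' hu hK y.2⟩
    have hF : StrictMono F := fun x y hxy => hmono x.2 y.2 hxy
    have hFs : Function.Surjective F := fun r =>
      ⟨⟨kappaInv D a a' u r, kappaInv_nonneg _⟩, Subtype.ext (hinv.1 r.2)⟩
    rw [continuousOn_iff_continuous_domRestrict]
    exact continuous_subtype_val.comp (hF.monotone.continuous_of_surjective hFs)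
  · refine tendsto_atTop.2 fun R => ?_
    filter_upwards [eventually_ge_atTop (kappaInv D a a' u (max R 0))] with y hy
    exact (le_max_left _ _).trans (le_kappa ha ha' hu hK (le_max_right _ _) hy)

end Comparison

/-! ### Geometry of the domain -/

section Geometry

variable {d : ℕ} {D : Set (E d)}

/-- The volume of the unit ball of `ℝ^d`. -/
noncomputable def ballConst (d : ℕ) : ℝ := √Real.pi ^ d / Real.Gamma ((d : ℝ) / 2 + 1)

theorem ballConst_pos (d : ℕ) : 0 < ballConst d :=
  div_pos (pow_pos (Real.sqrt_pos.2 Real.pi_pos) _) (Real.Gamma_pos_of_pos (by positivity))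

theorem volume_real_closedBall (hd : 0 < d) (x : E d) {r : ℝ} (hr : 0 ≤ r) :
    volume.real (Metric.closedBall x r) = r ^ d * ballConst d := by
  have : Nonempty (Fin d) := ⟨⟨0, hd⟩⟩
  have := ballConst_pos d
  rw [Measure.real, EuclideanSpace.volume_closedBall, Fintype.card_fin, ENNReal.toReal_mul,
    ENNReal.toReal_pow, ENNReal.toReal_ofReal hr, ENNReal.toReal_ofReal (by exact this.le)]
  rfl

/-- The identity Γ(d/2 + 1) = (d/2) Γ(d/2) exhibits the volume of the unit ball in the constant. -/
theorem kappaCoeff_eq (hd : 0 < d) (a : ℝ) :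
    kappaCoeff D a = a ^ 2 * ballConst d / 2 ^ (d + 4) * portion D *
      (inradius D / Metric.diam D) ^ d := by
  have hd' : (0 : ℝ) < d := by exact_mod_cast hd
  have hG : 0 < Real.Gamma ((d : ℝ) / 2) := Real.Gamma_pos_of_pos (by positivity)
  have h : Real.pi ^ ((d : ℝ) / 2) = √Real.pi ^ d := by
    rw [Real.sqrt_eq_rpow, ← Real.rpow_natCast, ← Real.rpow_mul Real.pi_pos.le]
    congr 1; ring
  unfold kappaCoeff ballConst
  rw [h, Real.Gamma_add_one (by positivity)]
  congr 2
  field_simp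
  ring

theorem two_mul_radius_le_diam (hd : 0 < d) (hD : IsCompact D) {c : E d} {r : ℝ} (hr : 0 ≤ r)
    (h : Metric.closedBall c r ⊆ D) : 2 * r ≤ Metric.diam D := by
  set v : E d := EuclideanSpace.single ⟨0, hd⟩ r with hv
  have hvn : ‖v‖ = r := by simp [hv, abs_of_nonneg hr]
  have h1 : c + v ∈ D := h (by simp [hvn])
  have h2 : c - v ∈ D := h (by simp [hvn])
  have := Metric.dist_le_diam_of_mem hD.isBounded h1 h2
  rw [dist_eq_norm, show c + v - (c - v) = (2 : ℝ) • v by rw [two_smul]; abel, norm_smul,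
    hvn] at this
  simpa using this

theorem exists_closedBall_subset (hint : (interior D).Nonempty) :
    ∃ c, ∃ ρ > 0, Metric.closedBall c ρ ⊆ D := by
  obtain ⟨c, hc⟩ := hint
  obtain ⟨ρ, hρ, h⟩ := Metric.nhds_basis_closedBall.mem_iff.1 (mem_interior_iff_mem_nhds.1 hc)
  exact ⟨c, ρ, hρ, h⟩

theorem inradius_pos (hd : 0 < d) (hD : IsCompact D) (hint : (interior D).Nonempty) :
    0 < inradius D := by
  obtain ⟨c, ρ, hρ, h⟩ := exists_closedBall_subset hint
  refine hρ.trans_le (le_csSup ⟨Metric.diam D, ?_⟩ ⟨hρ.le, c, h⟩)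
  rintro r ⟨hr, c, hc⟩
  linarith [two_mul_radius_le_diam hd hD hr hc]

theorem two_mul_inradius_le_diam (hd : 0 < d) (hD : IsCompact D) (hint : (interior D).Nonempty) :
    2 * inradius D ≤ Metric.diam D := by
  obtain ⟨c, ρ, hρ, h⟩ := exists_closedBall_subset hint
  have : inradius D ≤ Metric.diam D / 2 := by
    refine csSup_le ⟨ρ, hρ.le, c, h⟩ ?_
    rintro r ⟨hr, c, hc⟩
    linarith [two_mul_radius_le_diam hd hD hr hc]
  linarith

theorem portion_mul_le (hd : 0 < d) {x : E d} (hx : x ∈ D) {r : ℝ} (hr : 0 < r)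
    (hrD : r ≤ inradius D) :
    portion D * volume.real (Metric.closedBall x r) ≤ volume.real (Metric.closedBall x r ∩ D) := by
  have hpos : 0 < volume.real (Metric.closedBall x r) := by
    rw [volume_real_closedBall hd x hr.le]; have := ballConst_pos d; positivity
  rw [← le_div_iff₀ hpos]
  refine csInf_le ⟨0, ?_⟩ ⟨x, hx, r, hr, hrD, rfl⟩
  rintro t ⟨x, -, r, -, -, rfl⟩
  positivity

/-- The homothety with centre x ∈ D and ratio r / diam D maps D into itself, by convexity, and into
B(x,r). The image of a fixed ball of radius ρ in D therefore fills at least the fraction (ρ / diam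
D)^d of B(x,r). -/
theorem portion_pos (hd : 0 < d) (hD : IsCompact D) (hconv : Convex ℝ D)
    (hint : (interior D).Nonempty) : 0 < portion D := by
  obtain ⟨c, ρ, hρ, h⟩ := exists_closedBall_subset hint
  have hir := inradius_pos hd hD hint
  have hdiam : 0 < Metric.diam D := by linarith [two_mul_inradius_le_diam hd hD hint]
  have hcD : c ∈ D := h (Metric.mem_closedBall_self hρ.le)
  refine (show (0 : ℝ) < (ρ / Metric.diam D) ^ d by positivity).trans_le ?_
  refine le_csInf ⟨_, c, hcD, inradius D, hir, le_rfl, rfl⟩ ?_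
  rintro t ⟨x, hx, r, hr, hrD, rfl⟩
  rw [volume_real_closedBall hd x hr.le]
  have hB := ballConst_pos d
  rw [le_div_iff₀ (by positivity)]
  set τ := r / Metric.diam D with hτ
  have hτ0 : 0 < τ := by positivity
  have hτ1 : τ ≤ 1 := by
    rw [hτ, div_le_one hdiam]; linarith [two_mul_inradius_le_diam hd hD hint]
  have hsub : Metric.closedBall (x + τ • (c - x)) (τ * ρ) ⊆ Metric.closedBall x r ∩ D := by
    intro y hy
    set z := x + τ⁻¹ • (y - x) with hz
    have hzD : z ∈ D := by
      apply h
      rw [Metric.mem_closedBall, dist_eq_norm] at hy ⊢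
      have e : z - c = τ⁻¹ • (y - (x + τ • (c - x))) := by
        rw [hz, ← sub_sub y, smul_sub τ⁻¹ (y - x), smul_smul, inv_mul_cancel₀ hτ0.ne', one_smul]
        abel
      rw [e, norm_smul, Real.norm_of_nonneg (by positivity), inv_mul_le_iff₀ hτ0]
      exact hy
    have ey : y = x + τ • (z - x) := by
      rw [hz, add_sub_cancel_left, smul_smul, mul_inv_cancel₀ hτ0.ne', one_smul,
        add_sub_cancel]
    refine ⟨?_, ?_⟩
    · rw [Metric.mem_closedBall, dist_eq_norm, ey, add_sub_cancel_left, norm_smul,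
        Real.norm_of_nonneg hτ0.le, ← dist_eq_norm]
      calc τ * dist z x ≤ τ * Metric.diam D := by
            gcongr; exact Metric.dist_le_diam_of_mem hD.isBounded hzD hx
        _ = r := by rw [hτ]; field_simp
    · rw [ey]; exact hconv.add_smul_sub_mem hx hzD ⟨hτ0.le, hτ1⟩
  calc (ρ / Metric.diam D) ^ d * (r ^ d * ballConst d)
      = (τ * ρ) ^ d * ballConst d := by
        rw [hτ, ← mul_assoc, ← mul_pow]; congr 2; ring
    _ = volume.real (Metric.closedBall (x + τ • (c - x)) (τ * ρ)) := by
        rw [volume_real_closedBall hd _ (by positivity)]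
    _ ≤ _ := measureReal_mono hsub
        (measure_ne_top_of_subset inter_subset_left measure_closedBall_lt_top.ne)

theorem kappaCoeff_pos (hd : 0 < d) (hD : IsCompact D) (hconv : Convex ℝ D)
    (hint : (interior D).Nonempty) {a : ℝ} (ha : 0 < a) : 0 < kappaCoeff D a := by
  have h1 := portion_pos hd hD hconv hint
  have h2 := inradius_pos hd hD hint
  have h3 := two_mul_inradius_le_diam hd hD hint
  have h4 : 0 < Metric.diam D := by linarith
  have h5 := ballConst_pos d
  rw [kappaCoeff_eq hd]
  positivity

end Geometry

/-! ### Square integrable functions on the domain -/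

section SquareIntegrable

variable {d : ℕ} {D : Set (E d)}

theorem memLp_of_continuousOn (hD : IsCompact D) {h : E d → ℝ} (hh : ContinuousOn h D) :
    MemLp h 2 (volume.restrict D) := by
  obtain ⟨C, hC⟩ := hD.exists_bound_of_continuousOn hh
  have : IsFiniteMeasure (volume.restrict D) := isFiniteMeasure_restrict.2 hD.measure_lt_top.ne
  exact MemLp.of_bound (hh.aestronglyMeasurable_of_isCompact hD hD.measurableSet) C
    ((ae_restrict_iff' hD.measurableSet).2 (ae_of_all _ hC))

theorem toL2_eq {h : E d → ℝ} (hh : MemLp h 2 (volume.restrict D)) : toL2 D h = hh.toLp h :=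
  dif_pos hh

theorem coeFn_toL2 {h : E d → ℝ} (hh : MemLp h 2 (volume.restrict D)) :
    toL2 D h =ᵐ[volume.restrict D] h := by
  rw [toL2_eq hh]; exact hh.coeFn_toLp

theorem toL2_add {g h : E d → ℝ} (hg : MemLp g 2 (volume.restrict D))
    (hh : MemLp h 2 (volume.restrict D)) : toL2 D (g + h) = toL2 D g + toL2 D h := by
  rw [toL2_eq hg, toL2_eq hh, toL2_eq (hg.add hh), MemLp.toLp_add]

theorem toL2_sub {g h : E d → ℝ} (hg : MemLp g 2 (volume.restrict D))
    (hh : MemLp h 2 (volume.restrict D)) : toL2 D (g - h) = toL2 D g - toL2 D h := by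
  rw [toL2_eq hg, toL2_eq hh, toL2_eq (hg.sub hh), MemLp.toLp_sub]

theorem toL2_smul {h : E d → ℝ} (c : ℝ) (hh : MemLp h 2 (volume.restrict D)) :
    toL2 D (c • h) = c • toL2 D h := by
  rw [toL2_eq hh, toL2_eq (hh.const_smul c), MemLp.toLp_const_smul]

theorem norm_sq_toL2 {h : E d → ℝ} (hh : MemLp h 2 (volume.restrict D)) :
    ‖toL2 D h‖ ^ 2 = ∫ x in D, h x ^ 2 := by
  rw [← real_inner_self_eq_norm_sq, L2.inner_def]
  refine integral_congr_ae ?_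
  filter_upwards [coeFn_toL2 hh] with x hx
  rw [hx]; simp [sq]

/-- A Lipschitz function that is large at a point has a large norm in `L₂(D)`. -/
theorem two_mul_kappaInv_sq_le (hd : 0 < d) (hD : IsCompact D) (hconv : Convex ℝ D)
    (hint : (interior D).Nonempty) {a a' u : ℝ} (ha : 0 < a) (haa' : a ≤ a') (hu : 0 < u)
    {δ : E d → ℝ} (hδ : ContinuousOn δ D)
    (hlip : ∀ x ∈ D, ∀ y ∈ D, |δ x - δ y| ≤ 2 * u * ‖x - y‖) {y : E d} (hy : y ∈ D) {r : ℝ}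
    (hr : 0 ≤ r) (hrD : r ≤ Metric.diam D) (h : a * r ^ 2 / 2 ≤ |δ y|) :
    2 * kappaInv D a a' u r ^ 2 ≤ ‖toL2 D δ‖ ^ 2 := by
  rcases hr.eq_or_lt with rfl | hr
  · rw [kappaInv_zero]; simp
  have h1 := portion_pos hd hD hconv hint
  have h2 := inradius_pos hd hD hint
  have h3 := two_mul_inradius_le_diam hd hD hint
  have h4 : 0 < Metric.diam D := by linarith
  have h5 := ballConst_pos d
  have ha' : 0 < a' := ha.trans_le haa'
  have hmu := mu_pos ha ha' hu hr
  have mu1 : mu a a' u r ≤ r := by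
    unfold mu
    rw [div_le_iff₀ (by positivity)]
    have : a * r ≤ √(a * a' * r ^ 2 + 2 * (a' + a) * u * r + 4 * u ^ 2) := by
      apply Real.le_sqrt_of_sq_le
      have : a * a * r ^ 2 ≤ a * a' * r ^ 2 := by gcongr
      have : 0 < 2 * (a' + a) * u * r + 4 * u ^ 2 := by positivity
      nlinarith
    nlinarith
  have mu2 : mu a a' u r ≤ a * r ^ 2 / (4 * u) := by
    unfold mu
    have : 2 * u ≤ √(a * a' * r ^ 2 + 2 * (a' + a) * u * r + 4 * u ^ 2) := by
      apply Real.le_sqrt_of_sq_le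
      have : 0 < a * a' * r ^ 2 + 2 * (a' + a) * u * r := by positivity
      nlinarith
    exact div_le_div_of_nonneg_left (by positivity) (by positivity) (by linarith)
  -- Two constraints are met: ρ ≤ inradius D, because `mu` is at most r and r ≤ diam D; and δ drops
  -- by at most a r²/4 within distance ρ, because `mu` is at most a r²/(4u) and inradius D ≤ diam D
  -- / 2.
  set ρ := inradius D / Metric.diam D * mu a a' u r with hρ
  have hρ0 : 0 < ρ := by positivity
  have hρD : ρ ≤ inradius D := by
    rw [hρ, div_mul_eq_mul_div, div_le_iff₀ h4]
    gcongr
    linarith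
  have hρ2 : 2 * u * ρ ≤ a * r ^ 2 / 4 := by
    have : inradius D / Metric.diam D ≤ 1 / 2 := by
      rw [div_le_iff₀ h4]; linarith
    calc 2 * u * ρ ≤ 2 * u * (1 / 2 * (a * r ^ 2 / (4 * u))) := by rw [hρ]; gcongr
      _ = a * r ^ 2 / 4 := by field_simp
  have hbig : ∀ x ∈ Metric.closedBall y ρ ∩ D, (a * r ^ 2 / 4) ^ 2 ≤ δ x ^ 2 := by
    rintro x ⟨hx, hxD⟩
    rw [Metric.mem_closedBall, dist_eq_norm, norm_sub_rev] at hx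
    have e1 := hlip y hy x hxD
    have e2 : 2 * u * ‖y - x‖ ≤ 2 * u * ρ := by gcongr
    have e3 := abs_sub_abs_le_abs_sub (δ y) (δ x)
    rw [← sq_abs (δ x)]
    gcongr
    linarith
  have hmem := memLp_of_continuousOn hD hδ
  have hmeas : MeasurableSet (Metric.closedBall y ρ ∩ D) :=
    measurableSet_closedBall.inter hD.measurableSet
  have hfin : volume (Metric.closedBall y ρ ∩ D) ≠ ⊤ :=
    measure_ne_top_of_subset inter_subset_left measure_closedBall_lt_top.ne
  have hvol := portion_mul_le hd hy hρ0 hρD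
  rw [volume_real_closedBall hd y hρ0.le] at hvol
  have hint2 : IntegrableOn (fun x => δ x ^ 2) D volume := hmem.integrable_sq
  have low : (a * r ^ 2 / 4) ^ 2 * volume.real (Metric.closedBall y ρ ∩ D) ≤ ‖toL2 D δ‖ ^ 2 := by
    rw [norm_sq_toL2 hmem]
    calc (a * r ^ 2 / 4) ^ 2 * volume.real (Metric.closedBall y ρ ∩ D)
        ≤ ∫ x in Metric.closedBall y ρ ∩ D, δ x ^ 2 :=
          setIntegral_ge_of_const_le_real hmeas hfin hbig (hint2.mono_set inter_subset_right)
      _ ≤ _ := setIntegral_mono_set hint2 (ae_of_all _ fun x => sq_nonneg _)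
          inter_subset_right.eventuallyLE
  rw [kappaInv_sq ha (kappaCoeff_pos hd hD hconv hint ha).le, kappaCoeff_eq hd]
  refine le_trans ?_ ((mul_le_mul_of_nonneg_left hvol (sq_nonneg (a * r ^ 2 / 4))).trans low)
  -- The integral bound has 1/16 where `kappaInv` squared has 1/2^(d+4). Of the surplus 2^d only a
  -- factor 2 is kept; it later cancels the 2 in the second moment of the Laplace law.
  have hpow : (2 : ℝ) ≤ 2 ^ d := by
    calc (2 : ℝ) = 2 ^ 1 := by norm_num
      _ ≤ 2 ^ d := pow_le_pow_right₀ (by norm_num) hd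
  rw [hρ, mul_pow]
  calc 2 * (a ^ 2 * ballConst d / 2 ^ (d + 4) * portion D * (inradius D / Metric.diam D) ^ d *
        r ^ 4 * mu a a' u r ^ d)
      ≤ 2 ^ d * (a ^ 2 * ballConst d / 2 ^ (d + 4) * portion D *
        (inradius D / Metric.diam D) ^ d * r ^ 4 * mu a a' u r ^ d) := by gcongr
    _ = _ := by rw [pow_add]; field_simp; norm_num

end SquareIntegrable

/-! ### The class of objective functions -/

section ObjectiveClass

variable {d : ℕ} {D : Set (E d)} {α β u : ℝ}

theorem closure_interior_eq (hD : IsCompact D) (hconv : Convex ℝ D)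
    (hint : (interior D).Nonempty) : closure (interior D) = D := by
  rw [hconv.closure_interior_eq_closure_of_nonempty_interior hint, hD.isClosed.closure_eq]

theorem classS_continuousOn {h : E d → ℝ} (hh : h ∈ classS D α β u) : ContinuousOn h D :=
  hh.1.continuousOn

theorem classS_lipschitz (hconv : Convex ℝ D) {h : E d → ℝ} (hh : h ∈ classS D α β u) {x y : E d}
    (hx : x ∈ D) (hy : y ∈ D) : |h x - h y| ≤ u * ‖x - y‖ := by
  rw [← Real.norm_eq_abs]
  refine hconv.norm_image_sub_le_of_norm_hasFDerivWithin_le (f' := fderivWithin ℝ h D)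
    (fun z hz => (hh.1.differentiableOn (by norm_num) z hz).hasFDerivWithinAt) (fun z hz => ?_) hy hx
  have := hh.2.1 z hz
  rwa [gradientWithin, LinearIsometryEquiv.norm_map] at this

theorem classS_contDiffAt {h : E d → ℝ} (hh : h ∈ classS D α β u) {x : E d}
    (hx : x ∈ interior D) : ContDiffAt ℝ 2 h x :=
  hh.1.contDiffAt (mem_interior_iff_mem_nhds.1 hx)

theorem classS_differentiableAt_fderiv {h : E d → ℝ} (hh : h ∈ classS D α β u) {x : E d}
    (hx : x ∈ interior D) : DifferentiableAt ℝ (fderiv ℝ h) x :=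
  ((classS_contDiffAt hh hx).fderiv_right (m := 1) (by norm_num)).differentiableAt (by norm_num)

/-- On a segment in the interior, subtracting α/2 ‖v‖² t² leaves a nonnegative second derivative.
The inequality extends to D by continuity, the interior being dense in D. -/
theorem classS_strongConvexOn (hD : IsCompact D) (hconv : Convex ℝ D)
    (hint : (interior D).Nonempty) {h : E d → ℝ} (hh : h ∈ classS D α β u) :
    StrongConvexOn D α h := by
  have key : ∀ x ∈ interior D, ∀ y ∈ interior D, ∀ a b : ℝ, 0 ≤ a → 0 ≤ b → a + b = 1 →
      h (a • x + b • y) ≤ a * h x + b * h y - a * b * (α / 2 * ‖x - y‖ ^ 2) := by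
    intro x hx y hy a b ha hb hab
    set v := y - x with hv
    have hmem : ∀ t ∈ Icc (0 : ℝ) 1, x + t • v ∈ interior D := fun t ht =>
      hconv.interior.add_smul_sub_mem hx hy ht
    have hγ : ∀ t : ℝ, HasDerivAt (fun t : ℝ => x + t • v) v t := fun t => by
      simpa using ((hasDerivAt_id t).smul_const v).const_add x
    have hc : ConvexOn ℝ (Icc (0 : ℝ) 1)
        (fun t => h (x + t • v) - α / 2 * ‖v‖ ^ 2 * t ^ 2) := by
      refine convexOn_of_hasDerivWithinAt2_nonneg (convex_Icc 0 1)
        (f' := fun t => fderiv ℝ h (x + t • v) v - α * ‖v‖ ^ 2 * t)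
        (f'' := fun t => fderiv ℝ (fderiv ℝ h) (x + t • v) v v - α * ‖v‖ ^ 2) ?_ ?_ ?_ ?_
      · refine ContinuousOn.sub (hh.1.continuousOn.comp (by fun_prop) fun t ht =>
          interior_subset (hmem t ht)) (by fun_prop)
      · intro t ht
        have hm := hmem t (interior_subset ht)
        have h1 := ((classS_contDiffAt hh hm).differentiableAt (by norm_num)).hasFDerivAt
          |>.comp_hasDerivAt t (hγ t)
        have h2 := ((hasDerivAt_id t).pow 2).const_mul (α / 2 * ‖v‖ ^ 2)
        refine ((h1.sub h2).congr_deriv ?_).hasDerivWithinAt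
        simp; ring
      · intro t ht
        have hm := hmem t (interior_subset ht)
        have h1 := (classS_differentiableAt_fderiv hh hm).hasFDerivAt.comp_hasDerivAt t (hγ t)
        have h1' := h1.clm_apply (hasDerivAt_const t v)
        have h2 := (hasDerivAt_id t).const_mul (α * ‖v‖ ^ 2)
        refine ((h1'.sub h2).congr_deriv ?_).hasDerivWithinAt
        simp
      · intro t ht
        have := (hh.2.2 _ (hmem t (interior_subset ht)) v).1
        linarith
    have := hc.2 (left_mem_Icc.2 zero_le_one) (right_mem_Icc.2 zero_le_one) ha hb hab
    simp only [smul_eq_mul, mul_zero, zero_add, mul_one, zero_smul, add_zero, one_smul] at this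
    have e1 : x + b • v = a • x + b • y := by
      rw [hv, smul_sub, ← sub_eq_of_eq_add hab.symm, sub_smul, one_smul]; abel
    have e2 : x + v = y := by rw [hv]; abel
    rw [e1, e2] at this
    have e3 : ‖v‖ = ‖x - y‖ := by rw [hv, norm_sub_rev]
    rw [← e3]
    obtain rfl : a = 1 - b := by linarith
    nlinarith
  have hcl := closure_interior_eq hD hconv hint
  refine ⟨hconv, fun x hx y hy a b ha hb hab => ?_⟩
  have hcl2 : closure (interior D ×ˢ interior D) = D ×ˢ D := by
    rw [closure_prod_eq, hcl]
  have hcont := classS_continuousOn hh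
  have := le_on_closure (s := interior D ×ˢ interior D)
    (f := fun p : E d × E d => h (a • p.1 + b • p.2))
    (g := fun p => a * h p.1 + b * h p.2 - a * b * (α / 2 * ‖p.1 - p.2‖ ^ 2))
    (fun p hp => key p.1 hp.1 p.2 hp.2 a b ha hb hab)
    (by
      rw [hcl2]
      exact hcont.comp (by fun_prop) fun p hp => hconv hp.1 hp.2 ha hb hab)
    (by
      rw [hcl2]
      have h1 : ContinuousOn (fun p : E d × E d => h p.1) (D ×ˢ D) :=
        hcont.comp (by fun_prop) fun p hp => hp.1
      have h2 : ContinuousOn (fun p : E d × E d => h p.2) (D ×ˢ D) :=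
        hcont.comp (by fun_prop) fun p hp => hp.2
      exact ((h1.const_mul a).add (h2.const_mul b)).sub (by fun_prop)) (x := (x, y)) (by rw [hcl2]; exact ⟨hx, hy⟩)
  simpa using this

theorem convex_classS (hconv : Convex ℝ D) (hint : (interior D).Nonempty) :
    Convex ℝ (classS D α β u) := by
  intro g hg h hh a b ha hb hab
  refine ⟨(contDiffOn_const.smul hg.1).add (contDiffOn_const.smul hh.1), fun x hx => ?_,
    fun x hx v => ?_⟩
  · have hud : UniqueDiffWithinAt ℝ D x := uniqueDiffOn_convex hconv hint x hx
    have dg := hg.1.differentiableOn (by norm_num) x hx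
    have dh := hh.1.differentiableOn (by norm_num) x hx
    have e : gradientWithin (a • g + b • h) D x =
        a • gradientWithin g D x + b • gradientWithin h D x := by
      simp only [gradientWithin]
      rw [fderivWithin_add hud (dg.const_smul a) (dh.const_smul b),
        fderivWithin_const_smul hud dg, fderivWithin_const_smul hud dh]
      simp
    rw [e]
    calc ‖a • gradientWithin g D x + b • gradientWithin h D x‖
        ≤ a * ‖gradientWithin g D x‖ + b * ‖gradientWithin h D x‖ := by
          refine (norm_add_le _ _).trans_eq ?_
          rw [norm_smul, norm_smul, Real.norm_of_nonneg ha, Real.norm_of_nonneg hb]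
      _ ≤ a * u + b * u := by gcongr; exacts [hg.2.1 x hx, hh.2.1 x hx]
      _ = u := by rw [← add_mul, hab, one_mul]
  · have e : fderiv ℝ (fderiv ℝ (a • g + b • h)) x =
        a • fderiv ℝ (fderiv ℝ g) x + b • fderiv ℝ (fderiv ℝ h) x := by
      have e1 : fderiv ℝ (a • g + b • h) =ᶠ[𝓝 x] a • fderiv ℝ g + b • fderiv ℝ h := by
        filter_upwards [isOpen_interior.mem_nhds hx] with z hz
        have dg := (classS_contDiffAt hg hz).differentiableAt (by norm_num)
        have dh := (classS_contDiffAt hh hz).differentiableAt (by norm_num)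
        rw [fderiv_add (dg.const_smul a) (dh.const_smul b), fderiv_const_smul dg,
          fderiv_const_smul dh]
        rfl
      have dg := classS_differentiableAt_fderiv hg hx
      have dh := classS_differentiableAt_fderiv hh hx
      rw [e1.fderiv_eq, fderiv_add (dg.const_smul a) (dh.const_smul b), fderiv_const_smul dg,
        fderiv_const_smul dh]
    obtain ⟨g1, g2⟩ := hg.2.2 x hx v
    obtain ⟨h1, h2⟩ := hh.2.2 x hx v
    rw [e]
    simp only [add_apply, smul_apply, smul_eq_mul]
    obtain rfl : a = 1 - b := by linarith
    constructor <;> nlinarith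

/-! ### The `L₂(D)`-closure of `classS` and its continuous representatives -/

theorem convex_closure_toL2_classS (hD : IsCompact D) (hconv : Convex ℝ D)
    (hint : (interior D).Nonempty) : Convex ℝ (closure (toL2 D '' classS D α β u)) := by
  refine Convex.closure ?_
  rintro _ ⟨g, hg, rfl⟩ _ ⟨h, hh, rfl⟩ a b ha hb hab
  have mg := memLp_of_continuousOn hD (classS_continuousOn hg)
  have mh := memLp_of_continuousOn hD (classS_continuousOn hh)
  refine ⟨a • g + b • h, convex_classS hconv hint hg hh ha hb hab, ?_⟩
  rw [toL2_add (mg.const_smul a) (mh.const_smul b), toL2_smul a mg, toL2_smul b mh]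

/-- A property that holds almost everywhere on `D` holds on a dense subset of `D`. -/
theorem exists_mem_ball_of_ae (hD : IsCompact D) (hconv : Convex ℝ D)
    (hint : (interior D).Nonempty) {p : E d → Prop} (hp : ∀ᵐ x ∂(volume.restrict D), p x)
    {x : E d} (hx : x ∈ D) {ε : ℝ} (hε : 0 < ε) : ∃ y ∈ D, ‖x - y‖ < ε ∧ p y := by
  rw [ae_restrict_iff' hD.measurableSet] at hp
  rw [← closure_interior_eq hD hconv hint] at hx
  have hne : (Metric.ball x ε ∩ interior D).Nonempty :=
    mem_closure_iff.1 hx _ Metric.isOpen_ball (Metric.mem_ball_self hε)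
  have hpos := (Metric.isOpen_ball.inter isOpen_interior).measure_pos volume hne
  obtain ⟨y, hy, hpy⟩ := ((frequently_ae_mem_iff.2 hpos.ne').and_eventually hp).exists
  refine ⟨y, interior_subset hy.2, ?_, hpy (interior_subset hy.2)⟩
  rw [← dist_eq_norm, dist_comm]; exact hy.1

/-- A continuous function in the `L₂(D)`-closure of `classS` is a pointwise limit of elements of
`classS`. -/
theorem exists_seq_tendsto_of_mem_closure (hD : IsCompact D) (hconv : Convex ℝ D)
    (hint : (interior D).Nonempty) (hu : 0 < u) {g : E d → ℝ} (hg : ContinuousOn g D)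
    (hcl : toL2 D g ∈ closure (toL2 D '' classS D α β u)) :
    ∃ h : ℕ → E d → ℝ, (∀ n, h n ∈ classS D α β u) ∧
      ∀ x ∈ D, Tendsto (fun n => h n x) atTop (𝓝 (g x)) := by
  obtain ⟨w, hw, hwlim⟩ := mem_closure_iff_seq_limit.1 hcl
  choose h hS hh using hw
  obtain ⟨ns, -, hae⟩ := (tendstoInMeasure_of_tendsto_Lp hwlim).exists_seq_tendsto_ae
  refine ⟨fun n => h (ns n), fun n => hS _, fun x hx => ?_⟩
  have hae' : ∀ᵐ x ∂(volume.restrict D), Tendsto (fun n => h (ns n) x) atTop (𝓝 (g x)) := by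
    have h1 : ∀ᵐ x ∂(volume.restrict D), ∀ n, w (ns n) x = h (ns n) x :=
      ae_all_iff.2 fun n => by
        rw [← hh]; exact coeFn_toL2 (memLp_of_continuousOn hD (classS_continuousOn (hS _)))
    filter_upwards [hae, h1, coeFn_toL2 (memLp_of_continuousOn hD hg)] with x h2 h3 h4
    simpa only [h3, h4] using h2
  -- From almost everywhere to everywhere: the h n share the Lipschitz constant u, so convergence at
  -- a point y near x controls h n x up to ε.
  rw [Metric.tendsto_atTop]
  intro ε hε
  obtain ⟨δ, hδ, hgδ⟩ := Metric.continuousOn_iff.1 hg x hx (ε / 3) (by positivity)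
  obtain ⟨y, hy, hxy, hlim⟩ := exists_mem_ball_of_ae hD hconv hint hae' hx
    (show 0 < min δ (ε / (3 * u)) by positivity)
  obtain ⟨N, hN⟩ := Metric.tendsto_atTop.1 hlim (ε / 3) (by positivity)
  refine ⟨N, fun n hn => ?_⟩
  have e1 := hN n hn
  have e2 := hgδ y hy (by rw [dist_comm, dist_eq_norm]; exact hxy.trans_le (min_le_left _ _))
  have e3 := classS_lipschitz hconv (hS (ns n)) hx hy
  have e4 : u * ‖x - y‖ ≤ ε / 3 := by
    calc u * ‖x - y‖ ≤ u * (ε / (3 * u)) := by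
          gcongr; exact hxy.le.trans (min_le_right _ _)
      _ = ε / 3 := by field_simp
  rw [Real.dist_eq] at e1 e2 ⊢
  rw [abs_lt] at e1 e2 ⊢
  rw [abs_le] at e3
  constructor <;> linarith

theorem lipschitz_of_mem_closure (hD : IsCompact D) (hconv : Convex ℝ D)
    (hint : (interior D).Nonempty) (hu : 0 < u) {g : E d → ℝ} (hg : ContinuousOn g D)
    (hcl : toL2 D g ∈ closure (toL2 D '' classS D α β u)) {x y : E d} (hx : x ∈ D) (hy : y ∈ D) :
    |g x - g y| ≤ u * ‖x - y‖ := by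
  obtain ⟨h, hS, hlim⟩ := exists_seq_tendsto_of_mem_closure hD hconv hint hu hg hcl
  exact le_of_tendsto ((hlim x hx).sub (hlim y hy)).abs
    (Eventually.of_forall fun n => classS_lipschitz hconv (hS n) hx hy)

theorem strongConvexOn_of_mem_closure (hD : IsCompact D) (hconv : Convex ℝ D)
    (hint : (interior D).Nonempty) (hu : 0 < u) {g : E d → ℝ} (hg : ContinuousOn g D)
    (hcl : toL2 D g ∈ closure (toL2 D '' classS D α β u)) : StrongConvexOn D α g := by
  obtain ⟨h, hS, hlim⟩ := exists_seq_tendsto_of_mem_closure hD hconv hint hu hg hcl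
  refine ⟨hconv, fun x hx y hy a b ha hb hab => ?_⟩
  exact le_of_tendsto_of_tendsto (hlim _ (hconv hx hy ha hb hab))
    ((((hlim x hx).const_smul a).add ((hlim y hy).const_smul b)).sub_const _)
    (Eventually.of_forall fun n =>
      (classS_strongConvexOn hD hconv hint (hS n)).2 hx hy ha hb hab)

end ObjectiveClass

/-! ### Projections and minimizers -/

/-- The angle at y is obtuse: ⟪x - y, z - y⟫ ≤ 0, hence ‖z - x‖² ≥ ‖z - y‖² + ‖x - y‖². -/
theorem IsProj.norm_sub_le {H : Type*} [NormedAddCommGroup H] [InnerProductSpace ℝ H] {K : Set H}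
    (hK : Convex ℝ K) {x y z : H} (h : IsProj K x y) (hz : z ∈ K) : ‖z - y‖ ≤ ‖z - x‖ := by
  have hinf : ‖x - y‖ = ⨅ w : K, ‖x - w‖ := by
    have : Nonempty K := ⟨⟨y, h.1⟩⟩
    refine le_antisymm (le_ciInf fun w => h.2 w w.2) ?_
    exact ciInf_le ⟨0, by rintro _ ⟨w, rfl⟩; exact norm_nonneg _⟩ (⟨y, h.1⟩ : K)
  have h1 := (norm_eq_iInf_iff_real_inner_le_zero hK h.1).1 hinf z hz
  have h2 := norm_sub_sq_real (z - y) (x - y)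
  rw [sub_sub_sub_cancel_right, real_inner_comm] at h2
  nlinarith [norm_nonneg (z - x), norm_nonneg (z - y), sq_nonneg ‖x - y‖]

theorem StrongConvexOn.sum {d n : ℕ} {D : Set (E d)} (hconv : Convex ℝ D) {α : ℝ}
    {f : Fin n → E d → ℝ} (hf : ∀ i, StrongConvexOn D α (f i)) :
    StrongConvexOn D (n * α) (fun x => ∑ i, f i x) := by
  refine ⟨hconv, fun x hx y hy a b ha hb hab => ?_⟩
  have := Finset.sum_le_sum fun i (_ : i ∈ Finset.univ) => (hf i).2 hx hy ha hb hab
  refine this.trans_eq ?_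
  simp only [smul_eq_mul, Finset.sum_sub_distrib, Finset.sum_add_distrib, ← Finset.mul_sum,
    Finset.sum_const, Finset.card_univ, Fintype.card_fin, nsmul_eq_mul]
  ring

theorem convex_feasibleSet {d m s : ℕ} {D : Set (E d)} (hconv : Convex ℝ D)
    {G : Fin m → E d → ℝ} (hG : ∀ j, ConvexOn ℝ D (G j))
    (A : Matrix (Fin s) (Fin d) ℝ) (b : Fin s → ℝ) : Convex ℝ (feasibleSet D G A b) := by
  rintro x ⟨hx, hGx, hAx⟩ y ⟨hy, hGy, hAy⟩ c c' hc hc' hcc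
  refine ⟨hconv hx hy hc hc' hcc, fun j => ?_, ?_⟩
  · refine ((hG j).2 hx hy hc hc' hcc).trans ?_
    simp only [smul_eq_mul]
    nlinarith [hGx j, hGy j]
  · rw [WithLp.ofLp_add, WithLp.ofLp_smul, WithLp.ofLp_smul, Matrix.mulVec_add, Matrix.mulVec_smul,
      Matrix.mulVec_smul, hAx, hAy, ← add_smul, hcc, one_smul]

/-- Quadratic growth of a strongly convex function at a minimizer. -/
theorem IsArgmin.add_le {d : ℕ} {D X : Set (E d)} {F : E d → ℝ} {c : ℝ} {x y : E d}
    (hF : StrongConvexOn D c F) (hX : Convex ℝ X) (hXD : X ⊆ D) (hx : IsArgmin F X x)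
    (hy : y ∈ X) : F x + c / 2 * ‖x - y‖ ^ 2 ≤ F y := by
  -- Compare x with (1 - t)x + ty, divide by t, and then let t tend to 0.
  have key : ∀ t ∈ Ioc (0 : ℝ) 1, F x + (1 - t) * (c / 2 * ‖x - y‖ ^ 2) ≤ F y := by
    intro t ht
    have h1 := hF.2 (hXD hx.1) (hXD hy) (sub_nonneg.2 ht.2) ht.1.le (sub_add_cancel 1 t)
    have h2 := hx.2 _ (hX hx.1 hy (sub_nonneg.2 ht.2) ht.1.le (sub_add_cancel 1 t))
    simp only [smul_eq_mul] at h1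
    have h3 : t * (F x + (1 - t) * (c / 2 * ‖x - y‖ ^ 2)) ≤ t * F y := by linarith
    exact le_of_mul_le_mul_left h3 ht.1
  have hlim : Tendsto (fun t : ℝ => F x + (1 - t) * (c / 2 * ‖x - y‖ ^ 2)) (𝓝[>] 0)
      (𝓝 (F x + (1 - 0) * (c / 2 * ‖x - y‖ ^ 2))) :=
    ((by fun_prop : Continuous fun t : ℝ => F x + (1 - t) * (c / 2 * ‖x - y‖ ^ 2)).tendsto
      0).mono_left nhdsWithin_le_nhds
  rw [sub_zero, one_mul] at hlim
  exact le_of_tendsto hlim (eventually_of_mem (Ioc_mem_nhdsGT one_pos) key)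

/-! ### Deviation of the minimizer -/

section Deviation

/-- If one root reaches r, its capped term alone suffices. Otherwise no cap is active, and a sum of
nonnegative squares is at most the square of the sum. The cap keeps each piece below the diameter of
D, as the ball estimate requires. -/
theorem le_sum_min_sqrt {n : ℕ} {a r : ℝ} (ha : 0 < a) (hr : 0 ≤ r) {t : Fin n → ℝ}
    (h : a * r ^ 2 ≤ ∑ i, t i) : r ≤ ∑ i, min (√(max (t i) 0 / a)) r := by
  have hnn : ∀ i ∈ Finset.univ, 0 ≤ min (√(max (t i) 0 / a)) r := fun i _ =>
    le_min (Real.sqrt_nonneg _) hr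
  by_cases hex : ∃ i, r ≤ √(max (t i) 0 / a)
  · obtain ⟨i, hi⟩ := hex
    calc r = min (√(max (t i) 0 / a)) r := (min_eq_right hi).symm
      _ ≤ _ := Finset.single_le_sum hnn (Finset.mem_univ i)
  · push Not at hex
    have e : ∀ i, min (√(max (t i) 0 / a)) r = √(max (t i) 0 / a) := fun i => min_eq_left (hex i).le
    simp only [e] at hnn ⊢
    refine le_of_sq_le_sq ?_ (Finset.sum_nonneg hnn)
    calc r ^ 2 ≤ (∑ i, t i) / a := by rw [le_div_iff₀ ha]; linarith
      _ ≤ ∑ i, √(max (t i) 0 / a) ^ 2 := by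
        rw [Finset.sum_div]
        refine Finset.sum_le_sum fun i _ => ?_
        rw [Real.sq_sqrt (by positivity)]
        gcongr
        exact le_max_left _ _
      _ ≤ _ := Finset.sum_sq_le_sq_sum_of_nonneg hnn

variable {d n m s : ℕ} {D : Set (E d)} {α β u : ℝ}

/-- The deterministic core: it bounds the displacement of the minimizer by a sum over agents, each
term involving only that agent's `L₂(D)` error. -/
theorem norm_sub_argmin_le (hd : 0 < d) (hn : 0 < n) (hD : IsCompact D) (hconv : Convex ℝ D)
    (hint : (interior D).Nonempty) (hα : 0 < α) (hαβ : α < β) (hu : 0 < u)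
    {X : Set (E d)} (hX : Convex ℝ X) (hXD : X ⊆ D) {f g : Fin n → E d → ℝ}
    (hf : ∀ i, ContinuousOn (f i) D) (hg : ∀ i, ContinuousOn (g i) D)
    (hfS : ∀ i, toL2 D (f i) ∈ closure (toL2 D '' classS D α β u))
    (hgS : ∀ i, toL2 D (g i) ∈ closure (toL2 D '' classS D α β u)) {x y : E d}
    (hx : IsArgmin (fun z => ∑ i, f i z) X x) (hy : IsArgmin (fun z => ∑ i, g i z) X y) :
    ‖y - x‖ ≤ ∑ i, kappa D (n * α) (n * β) u (‖toL2 D (f i) - toL2 D (g i)‖ / √2) := by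
  have hn' : (0 : ℝ) < n := by exact_mod_cast hn
  have ha : 0 < n * α := by positivity
  have haa : n * α ≤ n * β := by gcongr
  have ha' := ha.trans_le haa
  have hK := kappaCoeff_pos hd hD hconv hint ha
  have hxD := hXD hx.1
  have hyD := hXD hy.1
  have h1 := hx.add_le (StrongConvexOn.sum hconv fun i =>
    strongConvexOn_of_mem_closure hD hconv hint hu (hf i) (hfS i)) hX hXD hy.1
  have h2 := hy.add_le (StrongConvexOn.sum hconv fun i =>
    strongConvexOn_of_mem_closure hD hconv hint hu (hg i) (hgS i)) hX hXD hx.1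
  rw [norm_sub_rev] at h1
  set r := ‖y - x‖ with hr
  set δ : Fin n → E d → ℝ := fun i => f i - g i with hδ
  have hsum : n * α * r ^ 2 ≤ ∑ i, (δ i y - δ i x) := by
    simp only [hδ, Pi.sub_apply, Finset.sum_sub_distrib]
    linarith
  refine (le_sum_min_sqrt ha (norm_nonneg _) hsum).trans (Finset.sum_le_sum fun i _ => ?_)
  set ri := min (√(max (δ i y - δ i x) 0 / (n * α))) r with hri
  have hri0 : 0 ≤ ri := le_min (Real.sqrt_nonneg _) (norm_nonneg _)
  have hriD : ri ≤ Metric.diam D := (min_le_right _ _).trans (by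
    rw [hr, ← dist_eq_norm]; exact Metric.dist_le_diam_of_mem hD.isBounded hyD hxD)
  have hrisq : n * α * ri ^ 2 ≤ max (δ i y - δ i x) 0 := by
    calc n * α * ri ^ 2 ≤ n * α * √(max (δ i y - δ i x) 0 / (n * α)) ^ 2 := by
          gcongr; exact min_le_left _ _
      _ = _ := by rw [Real.sq_sqrt (by positivity)]; field_simp
  -- The positive part of δ i y - δ i x is at most |δ i y| + |δ i x|, so one of the two values
  -- carries at least half.
  have hbig : ∃ z ∈ D, n * α * ri ^ 2 / 2 ≤ |δ i z| := by
    by_contra! hcon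
    have c1 := hcon y hyD
    have c2 := hcon x hxD
    have c3 : max (δ i y - δ i x) 0 ≤ |δ i y| + |δ i x| :=
      max_le ((le_abs_self _).trans (abs_sub _ _)) (by positivity)
    linarith
  obtain ⟨z, hz, hzbig⟩ := hbig
  have hlip : ∀ p ∈ D, ∀ q ∈ D, |δ i p - δ i q| ≤ 2 * u * ‖p - q‖ := fun p hp q hq => by
    have l1 := lipschitz_of_mem_closure hD hconv hint hu (hf i) (hfS i) hp hq
    have l2 := lipschitz_of_mem_closure hD hconv hint hu (hg i) (hgS i) hp hq
    have e : δ i p - δ i q = (f i p - f i q) - (g i p - g i q) := by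
      simp only [hδ, Pi.sub_apply]; ring
    rw [e]
    exact (abs_sub _ _).trans (by linarith)
  have key := two_mul_kappaInv_sq_le hd hD hconv hint ha haa hu ((hf i).sub (hg i)) hlip hz
    hri0 hriD hzbig
  apply le_kappa ha ha' hu hK hri0
  rw [le_div_iff₀ (by positivity)]
  rw [← toL2_sub (memLp_of_continuousOn hD (hf i)) (memLp_of_continuousOn hD (hg i))]
  refine le_of_sq_le_sq ?_ (norm_nonneg _)
  rw [mul_pow, Real.sq_sqrt (by norm_num)]
  linarith

end Deviation

/-! ### The perturbation procedure -/

section Perturbation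

variable {d : ℕ} {D : Set (E d)}

/-- On square-summable sequences `Phi` is the inverse of the coordinate isometry, whence Parseval's
identity. -/
theorem hasSum_Phi (e : HilbertBasis ℕ ℝ (L2 D)) {θ : ℕ → ℝ} (hθ : Summable fun k => θ k ^ 2) :
    HasSum (fun k => θ k • e k) (Phi e θ) ∧ ‖Phi e θ‖ ^ 2 = ∑' k, θ k ^ 2 := by
  have hmem : Memℓp θ 2 := memℓp_gen (by simpa using hθ)
  have h := e.hasSum_repr_symm (⟨θ, hmem⟩ : lp (fun _ : ℕ => ℝ) 2)
  have hP : Phi e θ = e.repr.symm ⟨θ, hmem⟩ := h.tsum_eq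
  refine ⟨hP ▸ h, ?_⟩
  rw [hP, LinearIsometryEquiv.norm_map]
  have := lp.norm_rpow_eq_tsum (p := 2) (by norm_num) (⟨θ, hmem⟩ : lp (fun _ : ℕ => ℝ) 2)
  simpa using this

theorem IsPerturbation.norm_sub_le (hD : IsCompact D) (hconv : Convex ℝ D)
    (hint : (interior D).Nonempty) {α β u : ℝ} {e : HilbertBasis ℕ ℝ (L2 D)} {f fs ft : E d → ℝ}
    (hf : f ∈ classS D α β u) {θ : ℕ → ℝ} {ε : ℝ}
    (h : IsPerturbation e (classS D α β u) f θ ε fs ft) :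
    ‖toL2 D f - toL2 D ft‖ ≤ ‖Phi e θ‖ + ε := by
  refine (h.2.2.2.norm_sub_le (convex_closure_toL2_classS hD hconv hint)
    (subset_closure ⟨f, hf, rfl⟩)).trans ?_
  calc ‖toL2 D f - toL2 D fs‖ = ‖(toL2 D f + Phi e θ - toL2 D fs) - Phi e θ‖ := by
        congr 1; abel
    _ ≤ ‖toL2 D f + Phi e θ - toL2 D fs‖ + ‖Phi e θ‖ := _root_.norm_sub_le _ _
    _ ≤ _ := by linarith [h.2.1]

/-- A majorant affine in N², with c independent of N: when N²/2 has mean y₀², the middle term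
averages to zero. It combines the tangent at y₀ with 2 y₀ (t - y₀) ≤ t² - y₀² for t = N/√2. -/
theorem kappa_norm_div_le {a a' u : ℝ} (ha : 0 < a) (ha' : 0 < a') (hu : 0 < u)
    (hK : 0 < kappaCoeff D a) {y₀ : ℝ} (hy₀ : 0 < y₀) : ∃ c, ∀ x N ε : ℝ, 0 ≤ x → 0 ≤ N → 0 ≤ ε →
      x ≤ N + ε → kappa D a a' u (x / √2) ≤
        kappa D a a' u y₀ + c * (N ^ 2 / 2 - y₀ ^ 2) + kappa D a a' u ε := by
  obtain ⟨c, hc, hct⟩ := kappa_tangent ha ha' hu hK hy₀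
  have hmono := (kappa_strictMonoOn ha ha' hu hK).monotoneOn
  refine ⟨c / (2 * y₀), fun x N ε hx hN hε hxN => ?_⟩
  have h2 : (1 : ℝ) ≤ √2 := Real.one_le_sqrt.2 (by norm_num)
  have hNs : (0 : ℝ) ≤ N / √2 := by positivity
  have hNe : N ^ 2 / 2 = (N / √2) ^ 2 := by rw [div_pow, Real.sq_sqrt (by norm_num)]
  have h3 : x / √2 ≤ N / √2 + ε := by
    calc x / √2 ≤ (N + ε) / √2 := by gcongr
      _ = N / √2 + ε / √2 := add_div _ _ _
      _ ≤ _ := by gcongr; exact div_le_self hε h2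
  have h4 := hmono (show (0 : ℝ) ≤ x / √2 by positivity) (show (0 : ℝ) ≤ N / √2 + ε by positivity) h3
  have h5 := kappa_subadditive ha ha' hu hK hNs hε
  have h6 := hct _ hNs
  have h7 : c * (N / √2 - y₀) ≤ c / (2 * y₀) * (N ^ 2 / 2 - y₀ ^ 2) := by
    rw [hNe, div_mul_eq_mul_div, le_div_iff₀ (by positivity), mul_assoc]
    gcongr
    nlinarith [sq_nonneg (N / √2 - y₀)]
  linarith

end Perturbation

/-! ### The Riemann zeta function at real arguments -/

theorem hasSum_zeta {s : ℝ} (hs : 1 < s) :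
    HasSum (fun k : ℕ => 1 / ((k : ℝ) + 1) ^ s) (zeta s) := by
  have hsum : Summable (fun k : ℕ => 1 / ((k : ℝ) + 1) ^ s) := by
    simpa using (summable_nat_add_iff 1).2 (Real.summable_one_div_nat_rpow.2 hs)
  have h := hsum.hasSum
  convert! h
  unfold zeta
  rw [zeta_eq_tsum_one_div_nat_add_one_cpow (by simpa using hs), ← Complex.ofReal_re (∑' k : ℕ, _),
    Complex.ofReal_tsum]
  congr 2
  ext k
  push_cast
  rw [Complex.ofReal_cpow (by positivity)]
  push_cast
  rfl

theorem zeta_pos {s : ℝ} (hs : 1 < s) : 0 < zeta s := by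
  rw [← (hasSum_zeta hs).tsum_eq]
  exact (hasSum_zeta hs).summable.tsum_pos (fun k => by positivity) 0 (by simp)

/-! ### The Laplace distribution -/

section Laplace

theorem integral_sq_mul_laplace_density {b : ℝ} (hb : 0 < b) :
    ∫ x, x ^ 2 * (1 / (2 * b) * Real.exp (-|x| / b)) = 2 * b ^ 2 := by
  have h1 : ∀ x : ℝ, x ^ 2 * (1 / (2 * b) * Real.exp (-|x| / b)) =
      (fun t : ℝ => t ^ 2 * (1 / (2 * b) * Real.exp (-t / b))) |x| := fun x => by simp
  rw [integral_congr_ae (ae_of_all _ h1),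
    integral_comp_abs (f := fun t => t ^ 2 * (1 / (2 * b) * Real.exp (-t / b)))]
  have h2 := Real.integral_rpow_mul_exp_neg_mul_Ioi (a := 3) (r := 1 / b) (by norm_num)
    (by positivity)
  have h3 : ∫ t in Ioi (0 : ℝ), t ^ 2 * (1 / (2 * b) * Real.exp (-t / b)) =
      1 / (2 * b) * ∫ t in Ioi (0 : ℝ), t ^ ((3 : ℝ) - 1) * Real.exp (-(1 / b * t)) := by
    rw [← integral_const_mul]
    refine setIntegral_congr_fun measurableSet_Ioi fun t _ => ?_
    have : t ^ ((3 : ℝ) - 1) = t ^ 2 := by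
      rw [show (3 : ℝ) - 1 = ((2 : ℕ) : ℝ) by norm_num, Real.rpow_natCast]
    simp only [this]
    rw [show -(1 / b * t) = -t / b by ring]
    ring
  have hG : Real.Gamma 3 = 2 := by
    have := Real.Gamma_nat_eq_factorial 2
    norm_num at this ⊢
  rw [h3, h2, hG, one_div_one_div, show (3 : ℝ) = ((3 : ℕ) : ℝ) by norm_num, Real.rpow_natCast]
  field_simp

theorem measurable_laplace_density (b : ℝ) :
    Measurable fun x : ℝ => ENNReal.ofReal (1 / (2 * b) * Real.exp (-|x| / b)) := by
  fun_prop

theorem lintegral_sq_laplace {b : ℝ} (hb : 0 < b) :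
    ∫⁻ x, ENNReal.ofReal (x ^ 2) ∂(laplace b) = ENNReal.ofReal (2 * b ^ 2) := by
  have hint := integral_sq_mul_laplace_density hb
  unfold laplace
  rw [lintegral_withDensity_eq_lintegral_mul _ (measurable_laplace_density b) (by fun_prop),
    -- Integrability follows from the computed value: the integral of a nonintegrable function would
    -- be 0.
    ← hint, ofReal_integral_eq_lintegral_ofReal (.of_integral_ne_zero (by rw [hint]; positivity))
    (ae_of_all _ fun x => by positivity)]
  refine lintegral_congr fun x => ?_
  rw [Pi.mul_apply, ← ENNReal.ofReal_mul (by positivity), mul_comm]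

/-- Translating the Laplace distribution of scale `b` by `c` increases the probability of an event
at most by the factor `exp (|c| / b)`. -/
theorem laplace_map_sub_le {b : ℝ} (hb : 0 < b) (c : ℝ) :
    (laplace b).map (fun x => x - c) ≤ ENNReal.ofReal (Real.exp (|c| / b)) • laplace b := by
  refine Measure.le_iff.2 fun s hs => ?_
  rw [Measure.map_apply (by fun_prop) hs, Measure.smul_apply, smul_eq_mul]
  unfold laplace
  rw [withDensity_apply _ (hs.preimage (by fun_prop)), withDensity_apply _ hs,
    ← lintegral_const_mul _ (measurable_laplace_density b)]
  -- Translation invariance puts both integrals over the same set; the densities then compare by |x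
  -- - c| ≤ |x| + |c|.
  have hmp : MeasurePreserving (fun x : ℝ => x - c) volume volume :=
    measurePreserving_sub_right volume c
  rw [← hmp.setLIntegral_comp_preimage hs (by fun_prop)]
  refine lintegral_mono fun x => ?_
  rw [← ENNReal.ofReal_mul (by positivity)]
  refine ENNReal.ofReal_le_ofReal ?_
  rw [mul_left_comm, ← Real.exp_add, ← add_div]
  gcongr
  linarith [abs_sub x c]

end Laplace

/-! ### Series of nonnegative random variables -/

section Series

variable {Ω : Type*} [MeasurableSpace Ω] {P : Measure Ω}

theorem tsum_of_lintegral_eq {Y : ℕ → Ω → ℝ} {v : ℕ → ℝ} (hY : ∀ k, AEMeasurable (Y k) P)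
    (hY0 : ∀ k ω, 0 ≤ Y k ω) (hv0 : ∀ k, 0 ≤ v k)
    (h : ∀ k, ∫⁻ ω, ENNReal.ofReal (Y k ω) ∂P = ENNReal.ofReal (v k)) (hv : Summable v) :
    (∀ᵐ ω ∂P, Summable fun k => Y k ω) ∧ Integrable (fun ω => ∑' k, Y k ω) P ∧
      ∫ ω, ∑' k, Y k ω ∂P = ∑' k, v k := by
  set T : Ω → ENNReal := fun ω => ∑' k, ENNReal.ofReal (Y k ω) with hT
  have hTm : AEMeasurable T P := AEMeasurable.tsum fun k => (hY k).ennreal_ofReal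
  have hTint : ∫⁻ ω, T ω ∂P = ENNReal.ofReal (∑' k, v k) := by
    rw [hT, lintegral_tsum fun k => (hY k).ennreal_ofReal, ENNReal.ofReal_tsum_of_nonneg hv0 hv]
    simp_rw [h]
  have hTne : ∫⁻ ω, T ω ∂P ≠ ⊤ := by rw [hTint]; exact ENNReal.ofReal_ne_top
  -- This holds also where the series diverges, both sides being 0 by convention.
  have htoReal : ∀ ω, (T ω).toReal = ∑' k, Y k ω := fun ω => by
    rw [hT, ENNReal.tsum_toReal_eq fun k => ENNReal.ofReal_ne_top]
    simp_rw [ENNReal.toReal_ofReal (hY0 _ ω)]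
  have hfin := ae_lt_top' hTm hTne
  refine ⟨?_, ?_, ?_⟩
  · filter_upwards [hfin] with ω hω
    have := ENNReal.summable_toReal hω.ne
    simpa only [ENNReal.toReal_ofReal (hY0 _ ω)] using this
  · simpa only [htoReal] using integrable_toReal_of_lintegral_ne_top hTm hTne
  · have := integral_toReal hTm hfin
    simp only [htoReal] at this
    rw [this, hTint, ENNReal.toReal_ofReal (tsum_nonneg hv0)]

/-- The squares of Laplace variables of scales `γ / (k + 1) ^ (q / 2)`. -/
theorem tsum_sq_laplace {η : ℕ → Ω → ℝ} {γ q p : ℝ} (hγ : 0 < γ) (hq : 1 < q) (hp : p = q / 2)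
    (h : ∀ k : ℕ, HasLaw (η k) (laplace (γ / ((k : ℝ) + 1) ^ p)) P) :
    (∀ᵐ ω ∂P, Summable fun k => η k ω ^ 2) ∧ Integrable (fun ω => ∑' k, η k ω ^ 2) P ∧
      ∫ ω, ∑' k, η k ω ^ 2 ∂P = 2 * γ ^ 2 * zeta q := by
  have hb : ∀ k : ℕ, 0 < γ / ((k : ℝ) + 1) ^ p := fun k => by positivity
  have e : ∀ k : ℕ, 2 * (γ / ((k : ℝ) + 1) ^ p) ^ 2 = 2 * γ ^ 2 * (1 / ((k : ℝ) + 1) ^ q) := by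
    intro k
    rw [div_pow, ← Real.rpow_natCast (_ ^ p), ← Real.rpow_mul (by positivity), hp]
    push_cast
    rw [div_mul_cancel₀ _ two_ne_zero]
    ring
  have hs := (hasSum_zeta hq).mul_left (2 * γ ^ 2)
  simp_rw [← e] at hs
  rw [← hs.tsum_eq]
  refine tsum_of_lintegral_eq (fun k => (h k).aemeasurable.pow_const 2) (fun k ω => sq_nonneg _)
    (fun k => by positivity) (fun k => ?_) hs.summable
  rw [(h k).lintegral_comp (f := fun x => ENNReal.ofReal (x ^ 2)) (by fun_prop),
    lintegral_sq_laplace (hb k)]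

end Series

/-! ### Comparison of laws -/

section Laws

/-- The product outer measure is the largest one bounded on boxes by the product of the factors, so
it suffices to compare on boxes after dividing by ∏ C i. -/
theorem pi_le_smul_pi {ι : Type*} [Fintype ι] {X : ι → Type*} [∀ i, MeasurableSpace (X i)]
    {ν ν' : ∀ i, Measure (X i)} [∀ i, SigmaFinite (ν' i)] {C : ι → ENNReal}
    (hC0 : ∀ i, C i ≠ 0) (hC : ∀ i, C i ≠ ⊤) (h : ∀ i, ν' i ≤ C i • ν i) :
    Measure.pi ν' ≤ (∏ i, C i) • Measure.pi ν := by
  have hP0 : ∏ i, C i ≠ 0 := Finset.prod_ne_zero_iff.2 fun i _ => hC0 i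
  have hP : ∏ i, C i ≠ ⊤ := ENNReal.prod_ne_top fun i _ => hC i
  have key : ((∏ i, C i)⁻¹ • Measure.pi ν').toOuterMeasure ≤
      OuterMeasure.pi fun i => (ν i).toOuterMeasure := by
    rw [OuterMeasure.le_pi]
    intro s _
    change ((∏ i, C i)⁻¹ • Measure.pi ν') (univ.pi s) ≤ ∏ i, ν i (s i)
    rw [Measure.smul_apply, smul_eq_mul, Measure.pi_pi]
    calc (∏ i, C i)⁻¹ * ∏ i, ν' i (s i) ≤ (∏ i, C i)⁻¹ * ∏ i, (C i * ν i (s i)) := by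
          gcongr with i; exact h i (s i)
      _ = _ := by
          rw [Finset.prod_mul_distrib, ← mul_assoc, ENNReal.inv_mul_cancel hP0 hP, one_mul]
  refine Measure.le_iff.2 fun s hs => ?_
  have h1 : ((∏ i, C i)⁻¹ • Measure.pi ν') s ≤ Measure.pi ν s := by
    refine (key s).trans ?_
    rw [Measure.pi]
    exact le_toMeasure_apply _ _ s
  rw [Measure.smul_apply, smul_eq_mul] at h1 ⊢
  rwa [ENNReal.inv_mul_le_iff hP0 hP] at h1

/-- A domination of laws passes to almost sure limits. -/
theorem map_le_smul_map_of_tendsto {Ω S : Type*} [MeasurableSpace Ω] {P : Measure Ω}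
    [IsProbabilityMeasure P] [TopologicalSpace S] [TopologicalSpace.PseudoMetrizableSpace S]
    [MeasurableSpace S] [BorelSpace S] {U V : Ω → S} {Uk Vk : ℕ → Ω → S}
    (hUk : ∀ k, AEMeasurable (Uk k) P) (hVk : ∀ k, AEMeasurable (Vk k) P)
    (hU : ∀ᵐ ω ∂P, Tendsto (fun k => Uk k ω) atTop (𝓝 (U ω)))
    (hV : ∀ᵐ ω ∂P, Tendsto (fun k => Vk k ω) atTop (𝓝 (V ω))) {C : ENNReal} (hC : C ≠ ⊤)
    (h : ∀ k, P.map (Vk k) ≤ C • P.map (Uk k)) : P.map V ≤ C • P.map U := by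
  have hUm : AEMeasurable U P := aemeasurable_of_tendsto_metrizable_ae _ hUk hU
  have hVm : AEMeasurable V P := aemeasurable_of_tendsto_metrizable_ae _ hVk hV
  have : IsProbabilityMeasure (P.map U) := Measure.isProbabilityMeasure_map hUm
  have : IsProbabilityMeasure (P.map V) := Measure.isProbabilityMeasure_map hVm
  have hlim : ∀ (φ : BoundedContinuousFunction S NNReal), (∀ x, φ x ≤ 1) →
      ∀ {W : Ω → S} {Wk : ℕ → Ω → S}, (∀ k, AEMeasurable (Wk k) P) →
      (∀ᵐ ω ∂P, Tendsto (fun k => Wk k ω) atTop (𝓝 (W ω))) →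
      Tendsto (fun k => ∫⁻ ω, φ (Wk k ω) ∂P) atTop (𝓝 (∫⁻ ω, φ (W ω) ∂P)) := by
    intro φ hφ W Wk hWk hW
    refine tendsto_lintegral_of_dominated_convergence' (fun _ => 1)
      (fun k => φ.continuous.measurable.coe_nnreal_ennreal.comp_aemeasurable (hWk k))
      (fun k => ae_of_all _ fun ω => ENNReal.coe_le_one_iff.2 (hφ _)) (by simp) ?_
    filter_upwards [hW] with ω hω
    exact ENNReal.tendsto_coe.2 ((φ.continuous.tendsto _).comp hω)
  have hφ : ∀ (φ : BoundedContinuousFunction S NNReal), (∀ x, φ x ≤ 1) →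
      ∫⁻ x, φ x ∂(P.map V) ≤ C * ∫⁻ x, φ x ∂(P.map U) := by
    intro φ hφ1
    have hm := φ.continuous.measurable.coe_nnreal_ennreal
    rw [lintegral_map' hm.aemeasurable hVm, lintegral_map' hm.aemeasurable hUm]
    refine le_of_tendsto_of_tendsto' (hlim φ hφ1 hVk hV)
      (ENNReal.Tendsto.const_mul (hlim φ hφ1 hUk hU) (Or.inr hC)) fun k => ?_
    rw [← lintegral_map' hm.aemeasurable (hVk k), ← lintegral_map' hm.aemeasurable (hUk k),
      ← smul_eq_mul, ← lintegral_smul_measure]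
    exact lintegral_mono' (h k) le_rfl
  -- Indicators of closed sets are limits of continuous functions with values in [0,1]. Inner
  -- regularity then passes from closed sets to all measurable sets.
  have hclosed : ∀ F : Set S, IsClosed F → P.map V F ≤ C * P.map U F := fun F hF =>
    le_of_tendsto_of_tendsto' (HasOuterApproxClosed.tendsto_lintegral_apprSeq hF _)
      (ENNReal.Tendsto.const_mul (HasOuterApproxClosed.tendsto_lintegral_apprSeq hF _)
        (Or.inr hC)) fun k => hφ _ (HasOuterApproxClosed.apprSeq_apply_le_one hF k)
  refine Measure.le_iff.2 fun s hs => ?_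
  rw [hs.measure_eq_iSup_isClosed_of_ne_top (measure_ne_top _ _)]
  refine iSup₂_le fun K hK => iSup_le fun hKc => (hclosed K hKc).trans ?_
  rw [Measure.smul_apply, smul_eq_mul]
  gcongr

end Laws

/-! ### Differential privacy -/

section Privacy

variable {d n : ℕ} {D : Set (E d)}

theorem secondCountableTopology_L2 (D : Set (E d)) : SecondCountableTopology (L2 D) := by
  have : Fact ((2 : ENNReal) ≠ ⊤) := ⟨by norm_num⟩
  infer_instance

/-- Cauchy-Schwarz after writing (k+1)^p = (k+1)^q · (k+1)^(-(q-p)). The bound does not depend on K.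
-/
theorem sum_abs_div_le (e : HilbertBasis ℕ ℝ (L2 D)) {q p γ : ℝ} (hγ : 0 < γ)
    (hqp : 1 < 2 * (q - p)) {g : L2 D} (hg : g ∈ adjSpace e q) (K : ℕ) :
    ∑ k ∈ Finset.range K, |e.repr g k| / (γ / ((k : ℝ) + 1) ^ p) ≤
      √(zeta (2 * (q - p))) / γ * adjNorm e q g := by
  have h1 : ∀ k : ℕ, |e.repr g k| / (γ / ((k : ℝ) + 1) ^ p) =
      (|((k : ℝ) + 1) ^ q * e.repr g k| * (1 / ((k : ℝ) + 1) ^ (q - p))) / γ := by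
    intro k
    have hk : (0 : ℝ) < (k : ℝ) + 1 := by positivity
    rw [abs_mul, abs_of_pos (Real.rpow_pos_of_pos hk q), Real.rpow_sub hk]
    field_simp
  simp_rw [h1]
  rw [← Finset.sum_div, div_mul_eq_mul_div]
  gcongr
  refine (Real.sum_mul_le_sqrt_mul_sqrt _ _ _).trans ?_
  rw [mul_comm]
  have hz := hasSum_zeta hqp
  gcongr
  · have h2 : ∀ k : ℕ, (1 / ((k : ℝ) + 1) ^ (q - p)) ^ 2 = 1 / ((k : ℝ) + 1) ^ (2 * (q - p)) := by
      intro k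
      rw [div_pow, one_pow, ← Real.rpow_natCast (_ ^ (q - p)), ← Real.rpow_mul (by positivity),
        mul_comm (q - p)]
      norm_num
    simp_rw [h2]
    exact sum_le_hasSum _ (fun k _ => by positivity) hz
  · refine Real.sqrt_le_sqrt ?_
    simp_rw [sq_abs]
    exact hg.sum_le_tsum _ (fun k _ => sq_nonneg _)

theorem isDiffPrivate (e : HilbertBasis ℕ ℝ (L2 D)) {q p γ eps : Fin n → ℝ}
    (hq : ∀ i, 1 < q i) (hp : ∀ i, p i = q i / 2) (hγ : ∀ i, 0 < γ i)
    (heps : ∀ i, eps i = √(zeta (2 * (q i - p i))) / γ i)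
    {Ω : Type*} [MeasurableSpace Ω] {P : Measure Ω} [IsProbabilityMeasure P]
    {η : Fin n → ℕ → Ω → ℝ}
    (hηlaw : ∀ i (k : ℕ), HasLaw (η i k) (laplace (γ i / ((k : ℝ) + 1) ^ p i)) P)
    (hηindep : iIndepFun (fun ik : Fin n × ℕ => η ik.1 ik.2) P)
    {𝒳 : Type*} [MeasurableSpace 𝒳] {Post : (Fin n → L2 D) → 𝒳} (hPost : Measurable Post) :
    IsDiffPrivate P e q eps (fun F ω => Post (fun i => F i + Phi e (fun k => η i k ω))) := by
  have := secondCountableTopology_L2 D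
  intro F F' i₀ hFF' hg O hO
  set g := F i₀ - F' i₀ with hgdef
  set c : Fin n → ℕ → ℝ := fun i k => if i = i₀ then e.repr g k else 0 with hc
  set C := ENNReal.ofReal (Real.exp (eps i₀ * adjNorm e (q i₀) g)) with hCdef
  let Uk : ℕ → Ω → Fin n → L2 D := fun K ω i => F i + ∑ k ∈ Finset.range K, η i k ω • e k
  -- The change from F to F' is absorbed into the noise: `Vk` is built on F with coefficients
  -- shifted by c, and converges to F' + Φ(η) because ∑ c i k • e k = F i - F' i.
  let Vk : ℕ → Ω → Fin n → L2 D := fun K ω i =>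
    F i + ∑ k ∈ Finset.range K, (η i k ω - c i k) • e k
  let U : Ω → Fin n → L2 D := fun ω i => F i + Phi e (fun k => η i k ω)
  let V : Ω → Fin n → L2 D := fun ω i => F' i + Phi e (fun k => η i k ω)
  have hηm : ∀ i k, AEMeasurable (η i k) P := fun i k => (hηlaw i k).aemeasurable
  have hsq : ∀ᵐ ω ∂P, ∀ i, Summable fun k => η i k ω ^ 2 :=
    ae_all_iff.2 fun i => (tsum_sq_laplace (hγ i) (hq i) (hp i) (hηlaw i)).1
  have hUk : ∀ K, AEMeasurable (Uk K) P := fun K => by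
    refine aemeasurable_pi_lambda _ fun i => AEMeasurable.const_add ?_ _
    exact Finset.aemeasurable_fun_sum _ fun k _ => (hηm i k).smul_const _
  have hVk : ∀ K, AEMeasurable (Vk K) P := fun K => by
    refine aemeasurable_pi_lambda _ fun i => AEMeasurable.const_add ?_ _
    exact Finset.aemeasurable_fun_sum _ fun k _ => ((hηm i k).sub_const _).smul_const _
  have hU : ∀ᵐ ω ∂P, Tendsto (fun K => Uk K ω) atTop (𝓝 (U ω)) := by
    filter_upwards [hsq] with ω hω
    exact tendsto_pi_nhds.2 fun i => (hasSum_Phi e (hω i)).1.tendsto_sum_nat.const_add _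
  have hV : ∀ᵐ ω ∂P, Tendsto (fun K => Vk K ω) atTop (𝓝 (V ω)) := by
    filter_upwards [hsq] with ω hω
    refine tendsto_pi_nhds.2 fun i => ?_
    have h1 : HasSum (fun k => c i k • e k) (F i - F' i) := by
      by_cases hi : i = i₀
      · subst hi
        simpa only [hc, if_true] using e.hasSum_repr g
      · simp [hc, hi, hFF' i hi]
    have h2 := ((hasSum_Phi e (hω i)).1.sub h1).tendsto_sum_nat.const_add (F i)
    have h3 : F i + (Phi e (fun k => η i k ω) - (F i - F' i)) = V ω i := by
      simp only [V]; abel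
    rw [h3] at h2
    simpa only [Vk, sub_smul] using h2
  have hmap : ∀ K, P.map (Vk K) ≤ C • P.map (Uk K) := by
    intro K
    -- At level K everything is the image under Ξ of a finite product of Laplace laws, and the shift
    -- acts coordinatewise through τ.
    let b : Fin n × Fin K → ℝ := fun j => γ j.1 / (((j.2 : ℕ) : ℝ) + 1) ^ p j.1
    have hb : ∀ j, 0 < b j := fun j => by have := hγ j.1; positivity
    let H : Ω → Fin n × Fin K → ℝ := fun ω j => η j.1 j.2 ω
    let Ξ : (Fin n × Fin K → ℝ) → Fin n → L2 D := fun z i => F i + ∑ k : Fin K, z (i, k) • e k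
    let τ : (Fin n × Fin K → ℝ) → Fin n × Fin K → ℝ := fun z j => z j - c j.1 j.2
    have hΞ : Measurable Ξ := (by fun_prop : Continuous Ξ).measurable
    have hτ : Measurable τ := by fun_prop
    have hprob : ∀ j, IsProbabilityMeasure (laplace (b j)) := fun j =>
      (hηlaw j.1 j.2).isProbabilityMeasure_iff.1 inferInstance
    have hH : HasLaw H (Measure.pi fun j => laplace (b j)) P := by
      refine iIndepFun.hasLaw_pi (fun j => hηlaw j.1 j.2) ?_
      exact hηindep.precomp (g := fun j : Fin n × Fin K => (j.1, (j.2 : ℕ)))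
        fun j j' h => by
          simp only [Prod.mk.injEq] at h
          exact Prod.ext h.1 (Fin.ext h.2)
    have eU : Uk K = Ξ ∘ H := by
      ext1 ω; funext i
      simp only [Uk, Ξ, H, Function.comp_apply]
      rw [Finset.sum_range]
    have eV : Vk K = (Ξ ∘ τ) ∘ H := by
      ext1 ω; funext i
      simp only [Vk, Ξ, H, τ, Function.comp_apply]
      rw [Finset.sum_range]
    rw [eU, eV, ← AEMeasurable.map_map_of_aemeasurable (hΞ.comp hτ).aemeasurable hH.aemeasurable,
      ← AEMeasurable.map_map_of_aemeasurable hΞ.aemeasurable hH.aemeasurable, hH.map_eq,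
      ← Measure.map_map hΞ hτ, ← Measure.map_smul]
    refine Measure.map_mono ?_ hΞ
    have hprob' : ∀ j, IsProbabilityMeasure ((laplace (b j)).map fun x => x - c j.1 j.2) :=
      fun j => Measure.isProbabilityMeasure_map (by fun_prop)
    have e1 : (Measure.pi fun j => laplace (b j)).map τ =
        Measure.pi fun j => (laplace (b j)).map fun x => x - c j.1 j.2 :=
      Measure.pi_map_pi (f := fun (j : Fin n × Fin K) (x : ℝ) => x - c j.1 j.2)
        (fun j => by fun_prop)
    rw [e1]
    refine (pi_le_smul_pi (fun j => (ENNReal.ofReal_pos.2 (Real.exp_pos _)).ne')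
      (fun j => ENNReal.ofReal_ne_top)
      fun j => laplace_map_sub_le (hb j) (c j.1 j.2)).trans ?_
    have hCle : ∏ j, ENNReal.ofReal (Real.exp (|c j.1 j.2| / b j)) ≤ C := by
      rw [← ENNReal.ofReal_prod_of_nonneg fun j _ => (Real.exp_pos _).le, ← Real.exp_sum]
      refine ENNReal.ofReal_le_ofReal (Real.exp_le_exp.2 ?_)
      have e2 : ∑ j, |c j.1 j.2| / b j =
          ∑ k ∈ Finset.range K, |e.repr g k| / (γ i₀ / ((k : ℝ) + 1) ^ p i₀) := by
        rw [Fintype.sum_prod_type, Finset.sum_eq_single i₀]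
        · rw [Finset.sum_range]; simp [hc, b]
        · intro i _ hi; simp [hc, hi]
        · simp
      rw [e2, heps]
      refine sum_abs_div_le e (hγ i₀) ?_ hg K
      have := hq i₀; have := hp i₀; linarith
    intro s
    rw [Measure.smul_apply, Measure.smul_apply, smul_eq_mul, smul_eq_mul]
    gcongr
  have hle := map_le_smul_map_of_tendsto hUk hVk hU hV (C := C) ENNReal.ofReal_ne_top hmap
    (Post ⁻¹' O)
  have hUm : AEMeasurable U P := aemeasurable_of_tendsto_metrizable_ae _ hUk hU
  have hVm : AEMeasurable V P := aemeasurable_of_tendsto_metrizable_ae _ hVk hV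
  rw [Measure.smul_apply, smul_eq_mul, Measure.map_apply_of_aemeasurable hVm (hPost hO),
    Measure.map_apply_of_aemeasurable hUm (hPost hO)] at hle
  exact hle

end Privacy

end PrivOpt

/-! ### Proof of the three claims -/

theorem mainTheorem6
    {d n m s : ℕ} (hd : 0 < d) (hn : 0 < n)
    -- domain, feasible set and objective functions
    (D : Set (PrivOpt.E d)) (hDcompact : IsCompact D) (hDconvex : Convex ℝ D)
    (hDint : (interior D).Nonempty)
    (G : Fin m → PrivOpt.E d → ℝ) (hG : ∀ j, ConvexOn ℝ D (G j))
    (A : Matrix (Fin s) (Fin d) ℝ) (b : Fin s → ℝ)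
    (α β ubar : ℝ) (hα : 0 < α) (hαβ : α < β) (hubar : 0 < ubar)
    (f : Fin n → PrivOpt.E d → ℝ) (hf : ∀ i, f i ∈ PrivOpt.classS D α β ubar)
    (e : HilbertBasis ℕ ℝ (PrivOpt.L2 D))
    -- design parameters; `eps i` is the privacy level and `vareps i` the smoothing accuracy
    (q p γ eps vareps : Fin n → ℝ)
    (hq : ∀ i, 1 < q i) (hp : ∀ i, p i = q i / 2) (hγ : ∀ i, 0 < γ i)
    (heps : ∀ i, eps i = Real.sqrt (PrivOpt.zeta (2 * (q i - p i))) / γ i)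
    (hvareps : ∀ i, 0 < vareps i)
    -- independent Laplace noise of scale `γ i / k ^ p i`, for `k = 1, 2, …`
    {Ω : Type*} [MeasurableSpace Ω] (P : Measure Ω) [IsProbabilityMeasure P]
    (η : Fin n → ℕ → Ω → ℝ)
    (hηlaw : ∀ i k, HasLaw (η i k) (PrivOpt.laplace (γ i / ((k : ℝ) + 1) ^ p i)) P)
    (hηindep : iIndepFun (fun ik : Fin n × ℕ => η ik.1 ik.2) P)
    -- smoothed and projected objective functions, and the two optimizers
    (fs ft : Fin n → Ω → PrivOpt.E d → ℝ)
    (hpert : ∀ᵐ ω ∂P, ∀ i, PrivOpt.IsPerturbation e (PrivOpt.classS D α β ubar)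
      (f i) (fun k => η i k ω) (vareps i) (fs i ω) (ft i ω))
    (xstar : PrivOpt.E d)
    (hxstar : PrivOpt.IsArgmin (fun x => ∑ i, f i x) (PrivOpt.feasibleSet D G A b) xstar)
    (xtilde : Ω → PrivOpt.E d) (hxtilde_meas : AEMeasurable xtilde P)
    (hxtilde : ∀ᵐ ω ∂P,
      PrivOpt.IsArgmin (fun x => ∑ i, ft i ω x) (PrivOpt.feasibleSet D G A b) (xtilde ω)) :
    -- the comparison function is of class `K_∞`, with the stated inverse
    (PrivOpt.IsClassKInfty (PrivOpt.kappa D (n * α) (n * β) ubar) ∧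
      InvOn (PrivOpt.kappa D (n * α) (n * β) ubar) (PrivOpt.kappaInv D (n * α) (n * β) ubar)
        (Ici 0) (Ici 0)) ∧
    -- privacy of the perturbed functions and of everything computed from them
    (∀ (𝒳 : Type*) [MeasurableSpace 𝒳] (Post : (Fin n → PrivOpt.L2 D) → 𝒳), Measurable Post →
      PrivOpt.IsDiffPrivate P e q eps
        (fun F ω => Post (fun i => F i + PrivOpt.Phi e (fun k => η i k ω)))) ∧
    -- accuracy
    Integrable (fun ω => ‖xtilde ω - xstar‖) P ∧
    ∫ ω, ‖xtilde ω - xstar‖ ∂P ≤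
      ∑ i, (PrivOpt.kappa D (n * α) (n * β) ubar (PrivOpt.zeta (q i) / eps i) +
        PrivOpt.kappa D (n * α) (n * β) ubar (vareps i)) := by
  have hn' : (0 : ℝ) < n := by exact_mod_cast hn
  have ha : 0 < n * α := by positivity
  have ha' : 0 < n * β := mul_pos hn' (hα.trans hαβ)
  have hK := PrivOpt.kappaCoeff_pos hd hDcompact hDconvex hDint ha
  refine ⟨⟨PrivOpt.kappa_isClassKInfty ha ha' hubar hK, PrivOpt.kappa_invOn ha ha' hubar hK⟩,
    fun 𝒳 _ Post hPost => PrivOpt.isDiffPrivate e hq hp hγ heps hηlaw hηindep hPost, ?_⟩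
  have hz : ∀ i, 0 < PrivOpt.zeta (q i) := fun i => PrivOpt.zeta_pos (hq i)
  -- With p = q/2 the exponent 2(q - p) is q, so the base point ζ/ϵ is half the second moment of the
  -- noise norm, under a square root.
  have heps' : ∀ i, PrivOpt.zeta (q i) / eps i = γ i * Real.sqrt (PrivOpt.zeta (q i)) := fun i => by
    have h1 := hz i
    have h2 := hγ i
    rw [heps, hp, show 2 * (q i - q i / 2) = q i by ring, div_div_eq_mul_div, div_eq_iff
      (Real.sqrt_pos.2 h1).ne', mul_assoc, Real.mul_self_sqrt h1.le, mul_comm]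
  have hy₀ : ∀ i, 0 < PrivOpt.zeta (q i) / eps i := fun i => by
    rw [heps']; exact mul_pos (hγ i) (Real.sqrt_pos.2 (hz i))
  have hy₀sq : ∀ i, (PrivOpt.zeta (q i) / eps i) ^ 2 = γ i ^ 2 * PrivOpt.zeta (q i) := fun i => by
    rw [heps', mul_pow, Real.sq_sqrt (hz i).le]
  choose c hc using fun i => PrivOpt.kappa_norm_div_le (D := D) ha ha' hubar hK (hy₀ i)
  have hmom := fun i => PrivOpt.tsum_sq_laplace (hγ i) (hq i) (hp i) (hηlaw i)
  have hX := PrivOpt.convex_feasibleSet hDconvex hG A b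
  have hXD : PrivOpt.feasibleSet D G A b ⊆ D := fun x hx => hx.1
  -- An integrable majorant whose middle term has mean zero; it gives finiteness and the exact bound
  -- together.
  set B : Fin n → Ω → ℝ := fun i ω =>
    PrivOpt.kappa D (n * α) (n * β) ubar (PrivOpt.zeta (q i) / eps i) +
      c i * ((∑' k, η i k ω ^ 2) / 2 - (PrivOpt.zeta (q i) / eps i) ^ 2) +
      PrivOpt.kappa D (n * α) (n * β) ubar (vareps i) with hB
  have hcentred : ∀ i, Integrable (fun ω =>
      (∑' k, η i k ω ^ 2) / 2 - (PrivOpt.zeta (q i) / eps i) ^ 2) P := fun i =>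
    ((hmom i).2.1.div_const 2).sub (integrable_const _)
  have hadd : ∀ i, Integrable (fun ω =>
      PrivOpt.kappa D (n * α) (n * β) ubar (PrivOpt.zeta (q i) / eps i) +
        c i * ((∑' k, η i k ω ^ 2) / 2 - (PrivOpt.zeta (q i) / eps i) ^ 2)) P := fun i =>
    (integrable_const _).add ((hcentred i).const_mul (c i))
  have hBint : ∀ i, Integrable (B i) P := fun i => (hadd i).add (integrable_const _)
  have hBval : ∀ i, ∫ ω, B i ω ∂P =
      PrivOpt.kappa D (n * α) (n * β) ubar (PrivOpt.zeta (q i) / eps i) +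
        PrivOpt.kappa D (n * α) (n * β) ubar (vareps i) := fun i => by
    rw [hB]
    simp only
    rw [integral_add (hadd i) (integrable_const _), integral_add (integrable_const _) ((hcentred i).const_mul (c i)),
      integral_const_mul, integral_sub ((hmom i).2.1.div_const 2) (integrable_const _),
      integral_div, (hmom i).2.2, hy₀sq]
    simp only [integral_const, probReal_univ, smul_eq_mul]
    ring
  have hbound : ∀ᵐ ω ∂P, ‖xtilde ω - xstar‖ ≤ ∑ i, B i ω := by
    filter_upwards [hpert, hxtilde, ae_all_iff.2 fun i => (hmom i).1] with ω h1 h2 h3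
    refine (PrivOpt.norm_sub_argmin_le hd hn hDcompact hDconvex hDint hα hαβ hubar hX hXD
      (fun i => PrivOpt.classS_continuousOn (hf i)) (fun i => (h1 i).2.2.1)
      (fun i => subset_closure ⟨f i, hf i, rfl⟩) (fun i => (h1 i).2.2.2.1) hxstar h2).trans ?_
    refine Finset.sum_le_sum fun i _ => ?_
    have h4 := hc i _ _ _ (norm_nonneg _) (norm_nonneg _) (hvareps i).le
      ((h1 i).norm_sub_le hDcompact hDconvex hDint (hf i))
    rwa [(PrivOpt.hasSum_Phi e (h3 i)).2] at h4
  have hsum := integrable_finsetSum Finset.univ fun i _ => hBint i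
  have hint : Integrable (fun ω => ‖xtilde ω - xstar‖) P :=
    hsum.mono' (hxtilde_meas.sub_const _).norm.aestronglyMeasurable
      (hbound.mono fun ω h => by rwa [norm_norm])
  refine ⟨hint, (integral_mono_ae hint hsum hbound).trans_eq ?_⟩
  rw [integral_finsetSum _ fun i _ => hBint i]
  exact Finset.sum_congr rfl fun i _ => hBval i
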